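/- **Setting.** Write $\phi_e$ for the partial recursive function with index $e$. For $A,B\subseteq\mathbb N$ let $A\to B$ be the set of indices $e$ such that $\phi_e$ is defined on all of $A$ and maps $A$ into $B$, and let $A\wedge B=\{\langle a,b\rangle : a\in A,\ b\in B\}$, for a recursive pairing $\langle\cdot,\cdot\rangle$. Let $\mathcal F(A)=\bigcup_{n}(\{m: m\ge n\}\to A)$, and let $\mathcal J$ be Pitts' local operator $$\mathcal J(A)=\bigcap\{B\subseteq\mathbb N : \{0\}\wedge A\subseteq B \text{ and } \{1\}\wedge\mathcal F(B)\subseteq B\}.$$ For families $\varphi,\chi:I\to\mathcal P(\mathbb N)$ write $\varphi\vdash\chi$ if $\bigcap_{i\in I}(\varphi(i)\to\mathcal J\chi(i))\neq\emptyset$. Let $\mathcal E\!f\!f_{\mathcal J}$ be the subtopos of the effective topos given by $\mathcal J$. Its objects are sets $X$ with a relation $[\cdot=\cdot]:X\times X\to\mathcal P(\mathbb N)$ that is symmetric and transitive with respect to $\vdash$ (conjunction being $\wedge$). Its morphisms $X\to Y$ are the relations $X\times Y\to\mathcal P(\mathbb N)$ that are strict, extensional, single-valued and total with respect to $\vdash$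 (existential quantification being union), up to equivalence $\dashv\vdash$. Composition is relational composition. In $\mathcal E\!f\!f_{\mathcal J}$ let $\Omega$ be the subobject classifier $(\mathcal P(\mathbb N),=)$ with $[A=B]=(A\to\mathcal JB)\wedge(B\to\mathcal JA)$. A set $X$ with a function $E:X\to\mathcal P(\mathbb N)$ is viewed as the object with $[x=y]=E(x)$ if $x=y$, and $[x=y]=\emptyset$ otherwise. Let $N=(\mathbb N,\ n\mapsto\{n\})$ be the natural numbers object. For $\psi:\mathbb N\to\mathbb N$ let $\mathcal N_\psi$ be the set of arithmetical functions $\alpha:\mathbb N\to\mathbb N$ modulo the relation "$\alpha\psi(n)=\beta\psi(n)$ for all large $n$", with $$E([\alpha])=\{e : \text{for some } \beta\in[\alpha],\ \phi_e \text{ is total and } \phi_e(n)\in\mathcal J\{\beta\psi(n)\} \text{ for all } n\}.$$ (Skolem's nonstandard model $\mathcal N$ is $\mathcal N_\psi$ for a strictly increasing $\mathcal J$-representable $\psi$ such that for any two arithmetical functions $\alpha,\beta$ one of $\alpha\psi(n)<\beta\psi(n)$, $\alpha\psi(n)=\beta\psi(n)$, $\alpha\psi(n)>\beta\psi(n)$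 holds for all large $n$.) **Proposition (Uniformity Principle).** Let $X$ be an object of $\mathcal E\!f\!f_{\mathcal J}$ which is a subquotient of $N$, that is, a quotient of a subobject of $N$. Then the natural map $X\to X^{\Omega}$, the transpose of the projection $\Omega\times X\to X$, is an isomorphism. In particular, the natural map $X\to X^\Omega$ is an isomorphism for $X=N$, for $X=N^N$, and, for every $\psi:\mathbb N\to\mathbb N$, for $X=\mathcal N_\psi$ and $X=\mathcal N_\psi^{\mathcal N_\psi}$; so it is one for $\mathcal N$ and $\mathcal N^{\mathcal N}$. -/

import Mathlib

open CategoryTheory MonoidalCategory CartesianMonoidalCategory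

namespace JRealizability

/-! ### Partial recursive application and local operators -/

/-- `app e n` is `φ_e(n)`: the partial recursive function with index `e`, applied to `n`. -/
def app (e n : ℕ) : Part ℕ :=
  (Denumerable.ofNat Nat.Partrec.Code e).eval n

/-- `A → B`: the indices of partial recursive functions that are defined on all of `A` and map
`A` into `B`. -/
def arr (A B : Set ℕ) : Set ℕ :=
  {e | ∀ a ∈ A, ∃ b ∈ app e a, b ∈ B}

/-- `A ∧ B = {⟨a, b⟩ | a ∈ A, b ∈ B}`. -/
def conj (A B : Set ℕ) : Set ℕ :=
  {n | ∃ a ∈ A, ∃ b ∈ B, n = Nat.pair a b}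

/-- Local operators `J : P(ℕ) → P(ℕ)`. -/
structure LocalOperator where
  toFun : Set ℕ → Set ℕ
  monotone : (⋂ (A : Set ℕ) (B : Set ℕ), arr (arr A B) (arr (toFun A) (toFun B))).Nonempty
  unit : (⋂ A : Set ℕ, arr A (toFun A)).Nonempty
  mult : (⋂ A : Set ℕ, arr (toFun (toFun A)) (toFun A)).Nonempty

instance : CoeFun LocalOperator (fun _ => Set ℕ → Set ℕ) := ⟨LocalOperator.toFun⟩

/-- The operator `L(F)` attached to `F : P(ℕ) → P(ℕ)`. -/
def leastLocal (F : Set ℕ → Set ℕ) (A : Set ℕ) : Set ℕ :=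
  ⋂₀ {B | conj {0} A ⊆ B ∧ conj {1} (F B) ⊆ B}

/-- The monotone function `F A = ⋃ₙ ({m | n ≤ m} → A)`. -/
def pittsF (A : Set ℕ) : Set ℕ :=
  ⋃ n : ℕ, arr (Set.Ici n) A

theorem app_partrec : Partrec₂ app :=
  Nat.Partrec.Code.eval_part.comp ((Computable.ofNat _).comp Computable.fst) Computable.snd

theorem exists_app {f : ℕ →. ℕ} (hf : Partrec f) : ∃ e, ∀ n, app e n = f n := by
  obtain ⟨c, hc⟩ := Nat.Partrec.Code.exists_code.1 (Partrec.nat_iff.1 hf)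
  exact ⟨Encodable.encode c, fun n => by simp [app, hc]⟩

theorem exists_smn {f : ℕ → ℕ →. ℕ} (hf : Partrec₂ f) :
    ∃ s : ℕ → ℕ, Computable s ∧ ∀ a n, app (s a) n = f a n := by
  have h2 : Partrec (fun n : ℕ => f n.unpair.1 n.unpair.2) :=
    hf.comp (Computable.fst.comp Computable.unpair) (Computable.snd.comp Computable.unpair)
  obtain ⟨c, hc⟩ := Nat.Partrec.Code.exists_code.1 (Partrec.nat_iff.1 h2)
  refine ⟨fun a => Encodable.encode (c.curry a), ?_, fun a n => ?_⟩
  · exact Computable.encode.comp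
      ((Nat.Partrec.Code.primrec₂_curry.comp (Primrec.const c) Primrec.id).to_comp)
  · simp [app, hc]

theorem mem_conj {A B : Set ℕ} {n : ℕ} :
    n ∈ conj A B ↔ n.unpair.1 ∈ A ∧ n.unpair.2 ∈ B := by
  constructor
  · rintro ⟨a, ha, b, hb, rfl⟩; simpa using ⟨ha, hb⟩
  · rintro ⟨ha, hb⟩; exact ⟨_, ha, _, hb, (Nat.pair_unpair n).symm⟩

theorem arr_mono {A A' B B' : Set ℕ} (hA : A' ⊆ A) (hB : B ⊆ B') : arr A B ⊆ arr A' B' :=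
  fun _ he a ha => let ⟨b, hb, hbB⟩ := he a (hA ha); ⟨b, hb, hB hbB⟩

theorem pittsF_mono {A B : Set ℕ} (h : A ⊆ B) : pittsF A ⊆ pittsF B :=
  Set.iUnion_mono fun _ => arr_mono subset_rfl h

theorem leastLocal_zero {F : Set ℕ → Set ℕ} {A : Set ℕ} {a : ℕ} (ha : a ∈ A) :
    Nat.pair 0 a ∈ leastLocal F A := fun _ hB => hB.1 ⟨0, rfl, a, ha, rfl⟩

theorem pitts_one {A : Set ℕ} {f : ℕ} (hf : f ∈ pittsF (leastLocal pittsF A)) :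
    Nat.pair 1 f ∈ leastLocal pittsF A :=
  fun _ hB => hB.2 ⟨1, rfl, f, pittsF_mono (Set.sInter_subset_of_mem hB) hf, rfl⟩

theorem pitts_ind {A B : Set ℕ} (h0 : ∀ a ∈ A, Nat.pair 0 a ∈ B)
    (h1 : ∀ f ∈ pittsF B, Nat.pair 1 f ∈ B) : leastLocal pittsF A ⊆ B := by
  refine Set.sInter_subset_of_mem ⟨?_, ?_⟩
  · rintro _ ⟨_, rfl, a, ha, rfl⟩; exact h0 a ha
  · rintro _ ⟨_, rfl, a, ha, rfl⟩; exact h1 a ha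

/-- Recursion along `leastLocal pittsF`: leaves are mapped by `h`, nodes are kept. -/
theorem pitts_rec {h : ℕ → ℕ →. ℕ} (hh : Partrec₂ h) :
    ∃ g : ℕ → ℕ →. ℕ, Partrec₂ g ∧ ∀ e (A C : Set ℕ),
      (∀ a ∈ A, ∃ b ∈ h e a, b ∈ leastLocal pittsF C) →
      ∀ x ∈ leastLocal pittsF A, ∃ y ∈ g e x, y ∈ leastLocal pittsF C := by
  -- `comp3 c f n` computes `c` at `⟨e, f n⟩`
  have hcomp : Partrec₂ (fun (p n : ℕ) =>
      (app p.unpair.2 n).bind fun m => app p.unpair.1.unpair.1 (Nat.pair p.unpair.1.unpair.2 m)) := by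
    have hp : Computable (fun q : (ℕ × ℕ) × ℕ => q.1.1.unpair) :=
      Computable.unpair.comp (Computable.fst.comp Computable.fst)
    have hp1 : Computable (fun q : (ℕ × ℕ) × ℕ => q.1.1.unpair.1.unpair) :=
      Computable.unpair.comp (Computable.fst.comp hp)
    refine Partrec.bind (app_partrec.comp
      (Computable.snd.comp (Computable.unpair.comp Computable.fst)) Computable.snd) ?_
    exact app_partrec.comp (Computable.fst.comp hp1)
      (Primrec₂.natPair.to_comp.comp (Computable.snd.comp hp1) Computable.snd)
  obtain ⟨s, hs, hs'⟩ := exists_smn hcomp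
  -- the body of the recursion, `c` being a code of the function itself
  let body : ℕ → ℕ →. ℕ := fun c n =>
    cond (decide (n.unpair.2.unpair.1 = 0)) (h n.unpair.1 n.unpair.2.unpair.2)
      (Part.some (Nat.pair 1 (s (Nat.pair (Nat.pair c n.unpair.1) n.unpair.2.unpair.2))))
  have hn : Computable (fun q : ℕ × ℕ => q.2.unpair) := Computable.unpair.comp Computable.snd
  have hn2 : Computable (fun q : ℕ × ℕ => q.2.unpair.2.unpair) :=
    Computable.unpair.comp (Computable.snd.comp hn)
  have hbody : Partrec₂ body := by
    refine Partrec.cond (c := fun q : ℕ × ℕ => decide (q.2.unpair.2.unpair.1 = 0)) ?_ ?_ ?_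
    · have := (Primrec.eq (α := ℕ)).decide.to_comp.comp (Computable.fst.comp hn2)
        (Computable.const 0)
      exact this
    · exact hh.comp (Computable.fst.comp hn) (Computable.snd.comp hn2)
    · have h2 : Computable (fun q : ℕ × ℕ => Nat.pair 1
          (s (Nat.pair (Nat.pair q.1 q.2.unpair.1) q.2.unpair.2.unpair.2))) :=
        Primrec₂.natPair.to_comp.comp (Computable.const 1) (hs.comp
          (Primrec₂.natPair.to_comp.comp
            (Primrec₂.natPair.to_comp.comp Computable.fst (Computable.fst.comp hn))
            (Computable.snd.comp hn2)))
      exact h2.partrec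
  obtain ⟨c, hc⟩ := Nat.Partrec.Code.fixed_point₂
    (f := fun c n => body (Encodable.encode c) n)
    (hbody.comp (Computable.encode.comp Computable.fst) Computable.snd)
  refine ⟨fun e x => app (Encodable.encode c) (Nat.pair e x),
    app_partrec.comp (Computable.const _) Primrec₂.natPair.to_comp, fun e A C hA => ?_⟩
  have key : ∀ n, app (Encodable.encode c) n = body (Encodable.encode c) n := fun n => by
    simp [app, hc]
  refine pitts_ind (B := {x | ∃ y ∈ app (Encodable.encode c) (Nat.pair e x),
    y ∈ leastLocal pittsF C}) ?_ ?_
  · intro a ha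
    simpa [key, body] using hA a ha
  · intro f hf
    obtain ⟨n, hn⟩ := Set.mem_iUnion.1 hf
    simp only [Set.mem_ofPred_eq, key, body]
    refine ⟨Nat.pair 1 (s (Nat.pair (Nat.pair (Encodable.encode c) e) f)), by simp, ?_⟩
    refine pitts_one (Set.mem_iUnion.2 ⟨n, fun m hm => ?_⟩)
    obtain ⟨b, hb, y, hy, hyC⟩ := hn m hm
    refine ⟨y, ?_, hyC⟩
    rw [hs']
    simpa using ⟨b, hb, hy⟩

/-- Pitts' local operator. -/
def pitts : LocalOperator where
  toFun := leastLocal pittsF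
  monotone := by
    have h1 : Partrec₂ (fun e a : ℕ => (app e a).bind fun b => Part.some (Nat.pair 0 b)) := by
      refine Partrec.bind (app_partrec.comp Computable.fst Computable.snd) ?_
      exact (Primrec₂.natPair.to_comp.comp (Computable.const 0) Computable.snd).partrec
    obtain ⟨g, hg, hg'⟩ := pitts_rec h1
    obtain ⟨s, hs, hs'⟩ := exists_smn hg
    obtain ⟨k, hk⟩ := exists_app (f := fun n => Part.some (s n)) hs.partrec
    refine ⟨k, Set.mem_iInter₂.2 fun A B e he => ⟨s e, by simp [hk], fun x hx => ?_⟩⟩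
    rw [hs']
    refine hg' e A B (fun a ha => ?_) x hx
    obtain ⟨b, hb, hbB⟩ := he a ha
    exact ⟨Nat.pair 0 b, Part.mem_bind_iff.2 ⟨b, hb, Part.mem_some _⟩, leastLocal_zero hbB⟩
  unit := by
    obtain ⟨k, hk⟩ := exists_app (f := fun n => Part.some (Nat.pair 0 n))
      (Primrec₂.natPair.to_comp.comp (Computable.const 0) Computable.id).partrec
    exact ⟨k, Set.mem_iInter.2 fun A a ha => ⟨_, by rw [hk]; exact Part.mem_some _,
      leastLocal_zero ha⟩⟩
  mult := by
    have h1 : Partrec₂ (fun _ a : ℕ => Part.some a) := Computable.snd.partrec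
    obtain ⟨g, hg, hg'⟩ := pitts_rec h1
    obtain ⟨k, hk⟩ := exists_app (f := fun n => g 0 n)
      (hg.comp (Computable.const 0) Computable.id)
    refine ⟨k, Set.mem_iInter.2 fun A x hx => ?_⟩
    rw [hk]
    exact hg' 0 (leastLocal pittsF A) A (fun a ha => ⟨a, Part.mem_some _, ha⟩) x hx

/-! ### The logic of `J`-realizability -/

section Logic

variable {J : LocalOperator}

/-- `Ent J φ ψ`: the entailment `φ ⊢ ψ` between families of sets of realizers, that is
`⋂ᵢ (φ i → J (ψ i))` is nonempty. -/
def Ent (J : LocalOperator) {I : Type*} (φ ψ : I → Set ℕ) : Prop :=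
  (⋂ i, arr (φ i) (J (ψ i))).Nonempty

/-- Implication of the logic of `J`-realizability. -/
def imp (J : LocalOperator) (A B : Set ℕ) : Set ℕ := arr A (J B)

/-- Bi-implication of the logic of `J`-realizability. -/
def biimp (J : LocalOperator) (A B : Set ℕ) : Set ℕ := conj (imp J A B) (imp J B A)

/-- Universal quantification of the logic of `J`-realizability. -/
def all (J : LocalOperator) {Y : Type*} (φ : Y → Set ℕ) : Set ℕ := ⋂ y, J (φ y)

/-- Existential quantification of the logic of `J`-realizability. -/
def ex {Y : Type*} (φ : Y → Set ℕ) : Set ℕ := ⋃ y, φ y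

theorem ent_iff {I : Type*} {φ ψ : I → Set ℕ} :
    Ent J φ ψ ↔ ∃ e, ∀ i, ∀ a ∈ φ i, ∃ b ∈ app e a, b ∈ J (ψ i) := by
  simp [Ent, Set.Nonempty, arr]

/-- To prove an entailment it suffices to give a partial recursive function. -/
theorem ent_of {I : Type*} {φ ψ : I → Set ℕ} (f : ℕ →. ℕ) (hf : Partrec f)
    (h : ∀ i, ∀ a ∈ φ i, ∃ b ∈ f a, b ∈ J (ψ i)) : Ent J φ ψ := by
  obtain ⟨e, he⟩ := exists_app hf
  exact ent_iff.2 ⟨e, fun i a ha => by rw [he]; exact h i a ha⟩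

variable (J) in
theorem exists_ret : ∃ r : ℕ →. ℕ, Partrec r ∧ ∀ (A : Set ℕ), ∀ a ∈ A, ∃ b ∈ r a, b ∈ J A := by
  obtain ⟨u, hu⟩ := J.unit
  exact ⟨app u, app_partrec.comp (Computable.const u) Computable.id,
    fun A a ha => Set.mem_iInter.1 hu A a ha⟩

variable (J) in
theorem exists_bnd : ∃ g : ℕ → ℕ →. ℕ, Partrec₂ g ∧ ∀ e (A B : Set ℕ), e ∈ arr A (J B) →
    ∀ x ∈ J A, ∃ y ∈ g e x, y ∈ J B := by
  obtain ⟨m, hm⟩ := J.monotone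
  obtain ⟨d, hd⟩ := J.mult
  refine ⟨fun e x => (app m e).bind fun k => (app k x).bind fun z => app d z, ?_, ?_⟩
  · refine Partrec.bind (app_partrec.comp (Computable.const m) Computable.fst) ?_
    refine Partrec.bind (app_partrec.comp Computable.snd
      (Computable.snd.comp Computable.fst)) ?_
    exact app_partrec.comp (Computable.const d) Computable.snd
  · intro e A B he x hx
    obtain ⟨k, hk, hk'⟩ := Set.mem_iInter₂.1 hm A (J B) e he
    obtain ⟨z, hz, hz'⟩ := hk' x hx
    obtain ⟨y, hy, hy'⟩ := Set.mem_iInter.1 hd B z hz'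
    exact ⟨y, Part.mem_bind_iff.2 ⟨k, hk, Part.mem_bind_iff.2 ⟨z, hz, hy⟩⟩, hy'⟩

namespace Ent

variable {I K : Type*}

theorem of_subset {φ ψ : I → Set ℕ} (h : ∀ i, φ i ⊆ ψ i) : Ent J φ ψ := by
  obtain ⟨r, hr, hr'⟩ := exists_ret J
  exact ent_of r hr fun i a ha => hr' _ a (h i ha)

theorem refl (φ : I → Set ℕ) : Ent J φ φ := of_subset fun _ => subset_rfl

theorem trans {φ ψ χ : I → Set ℕ} (h : Ent J φ ψ) (h' : Ent J ψ χ) : Ent J φ χ := by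
  obtain ⟨g, hg, hg'⟩ := exists_bnd J
  obtain ⟨e, he⟩ := ent_iff.1 h
  obtain ⟨e', he'⟩ := ent_iff.1 h'
  refine ent_of (fun a => (app e a).bind fun b => g e' b) ?_ fun i a ha => ?_
  · exact Partrec.bind (app_partrec.comp (Computable.const e) Computable.id)
      (hg.comp (Computable.const e') Computable.snd)
  · obtain ⟨b, hb, hb'⟩ := he i a ha
    obtain ⟨c, hc, hc'⟩ := hg' e' _ _ (he' i) b hb'
    exact ⟨c, Part.mem_bind_iff.2 ⟨b, hb, hc⟩, hc'⟩

theorem subst {φ ψ : I → Set ℕ} (h : Ent J φ ψ) (f : K → I) :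
    Ent J (fun k => φ (f k)) (fun k => ψ (f k)) := by
  obtain ⟨e, he⟩ := ent_iff.1 h
  exact ent_iff.2 ⟨e, fun k => he (f k)⟩

/-- Transport of a judgement to a later stage. -/
theorem pull {Γ φ : I → Set ℕ} (h : Ent J Γ φ) {f : K → I} {Δ : K → Set ℕ}
    (hf : Ent J Δ (fun k => Γ (f k))) : Ent J Δ (fun k => φ (f k)) :=
  hf.trans (h.subst f)

theorem fst {Γ φ ψ : I → Set ℕ} (h : Ent J Γ (fun i => conj (φ i) (ψ i))) : Ent J Γ φ := by
  refine h.trans ?_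
  obtain ⟨r, hr, hr'⟩ := exists_ret J
  refine ent_of (fun a => r a.unpair.1) (hr.comp (Computable.fst.comp Computable.unpair)) ?_
  exact fun i a ha => hr' _ _ (mem_conj.1 ha).1

theorem snd {Γ φ ψ : I → Set ℕ} (h : Ent J Γ (fun i => conj (φ i) (ψ i))) : Ent J Γ ψ := by
  refine h.trans ?_
  obtain ⟨r, hr, hr'⟩ := exists_ret J
  refine ent_of (fun a => r a.unpair.2) (hr.comp (Computable.snd.comp Computable.unpair)) ?_
  exact fun i a ha => hr' _ _ (mem_conj.1 ha).2

theorem and {Γ φ ψ : I → Set ℕ} (h : Ent J Γ φ) (h' : Ent J Γ ψ) :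
    Ent J Γ (fun i => conj (φ i) (ψ i)) := by
  obtain ⟨r, hr, hr'⟩ := exists_ret J
  obtain ⟨g, hg, hg'⟩ := exists_bnd J
  obtain ⟨e, he⟩ := ent_iff.1 h
  obtain ⟨e', he'⟩ := ent_iff.1 h'
  have h1 : Partrec₂ (fun a b : ℕ => r (Nat.pair a b)) :=
    hr.comp (Primrec₂.natPair.to_comp.comp Computable.fst Computable.snd)
  obtain ⟨s, hs, hs'⟩ := exists_smn h1
  have h2 : Partrec₂ (fun v a : ℕ => g (s a) v) :=
    hg.comp (hs.comp Computable.snd) Computable.fst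
  obtain ⟨t, ht, ht'⟩ := exists_smn h2
  refine ent_of (fun a => (app e a).bind fun u => (app e' a).bind fun v => g (t v) u) ?_ ?_
  · refine Partrec.bind (app_partrec.comp (Computable.const e) Computable.id) ?_
    refine Partrec.bind (app_partrec.comp (Computable.const e') Computable.fst) ?_
    exact hg.comp (ht.comp Computable.snd) (Computable.snd.comp Computable.fst)
  · intro i a ha
    obtain ⟨u, hu, hu'⟩ := he i a ha
    obtain ⟨v, hv, hv'⟩ := he' i a ha
    have h3 : t v ∈ arr (φ i) (J (conj (φ i) (ψ i))) := by
      intro x hx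
      rw [ht']
      refine hg' (s x) (ψ i) _ (fun y hy => ?_) v hv'
      rw [hs']
      exact hr' _ _ ⟨x, hx, y, hy, rfl⟩
    obtain ⟨z, hz, hz'⟩ := hg' _ _ _ h3 u hu'
    exact ⟨z, Part.mem_bind_iff.2 ⟨u, hu, Part.mem_bind_iff.2 ⟨v, hv, hz⟩⟩, hz'⟩

theorem impI' {Γ φ ψ : I → Set ℕ} (h : Ent J (fun i => conj (Γ i) (φ i)) ψ) :
    Ent J Γ (fun i => imp J (φ i) (ψ i)) := by
  obtain ⟨r, hr, hr'⟩ := exists_ret J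
  obtain ⟨e, he⟩ := ent_iff.1 h
  have h1 : Partrec₂ (fun a b : ℕ => app e (Nat.pair a b)) :=
    app_partrec.comp (Computable.const e)
      (Primrec₂.natPair.to_comp.comp Computable.fst Computable.snd)
  obtain ⟨s, hs, hs'⟩ := exists_smn h1
  refine ent_of (fun a => r (s a)) (hr.comp hs) fun i a ha => hr' _ _ fun x hx => ?_
  rw [hs']
  exact he i _ ⟨a, ha, x, hx, rfl⟩

theorem impI {Γ φ ψ : I → Set ℕ}
    (h : ∀ Δ : I → Set ℕ, Ent J Δ Γ → Ent J Δ φ → Ent J Δ ψ) :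
    Ent J Γ (fun i => imp J (φ i) (ψ i)) :=
  impI' (h _ (refl _).fst (refl _).snd)

theorem mp {Γ φ ψ : I → Set ℕ} (h : Ent J Γ (fun i => imp J (φ i) (ψ i))) (h' : Ent J Γ φ) :
    Ent J Γ ψ := by
  refine (h.and h').trans (ent_of (fun n => app n.unpair.1 n.unpair.2) ?_ ?_)
  · exact app_partrec.comp (Computable.fst.comp Computable.unpair)
      (Computable.snd.comp Computable.unpair)
  · exact fun i a ha => (mem_conj.1 ha).1 _ (mem_conj.1 ha).2

theorem exI {Y : Type*} {Γ : I → Set ℕ} {φ : I → Y → Set ℕ} (y : I → Y)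
    (h : Ent J Γ (fun i => φ i (y i))) : Ent J Γ (fun i => ex (φ i)) :=
  h.trans (of_subset fun i => Set.subset_iUnion (φ i) (y i))

theorem exE {Y : Type*} {Γ χ : I → Set ℕ} {φ : I → Y → Set ℕ} (h : Ent J Γ (fun i => ex (φ i)))
    (k : ∀ Δ : I × Y → Set ℕ, Ent J Δ (fun p => Γ p.1) → Ent J Δ (fun p => φ p.1 p.2) →
      Ent J Δ (fun p => χ p.1)) : Ent J Γ χ := by
  have h1 : Ent J (fun p : I × Y => conj (Γ p.1) (φ p.1 p.2)) (fun p => χ p.1) :=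
    k _ (refl _).fst (refl _).snd
  refine ((refl Γ).and h).trans ?_
  obtain ⟨e, he⟩ := ent_iff.1 h1
  refine ent_iff.2 ⟨e, fun i a ha => ?_⟩
  obtain ⟨h2, h3⟩ := mem_conj.1 ha
  obtain ⟨y, hy⟩ := Set.mem_iUnion.1 h3
  exact he (i, y) a (mem_conj.2 ⟨h2, hy⟩)

theorem allI {Y : Type*} {Γ : I → Set ℕ} {φ : I → Y → Set ℕ}
    (h : Ent J (fun p : I × Y => Γ p.1) (fun p => φ p.1 p.2)) :
    Ent J Γ (fun i => all J (φ i)) := by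
  obtain ⟨r, hr, hr'⟩ := exists_ret J
  obtain ⟨e, he⟩ := ent_iff.1 h
  by_cases hY : Nonempty Y
  · refine ent_of (fun a => (app e a).bind r) ?_ fun i a ha => ?_
    · exact Partrec.bind (app_partrec.comp (Computable.const e) Computable.id)
        (hr.comp Computable.snd)
    · obtain ⟨y⟩ := hY
      obtain ⟨b, hb, hb'⟩ := he (i, y) a ha
      have h4 : b ∈ all J (φ i) := Set.mem_iInter.2 fun z => by
        obtain ⟨c, hc, hc'⟩ := he (i, z) a ha
        rwa [Part.mem_unique hb hc]
      obtain ⟨c, hc, hc'⟩ := hr' _ b h4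
      exact ⟨c, Part.mem_bind_iff.2 ⟨b, hb, hc⟩, hc'⟩
  · exact of_subset fun i a _ => Set.mem_iInter.2 fun z => (hY ⟨z⟩).elim

theorem allE {Y : Type*} {Γ : I → Set ℕ} {φ : I → Y → Set ℕ}
    (h : Ent J Γ (fun i => all J (φ i))) (y : I → Y) : Ent J Γ (fun i => φ i (y i)) := by
  refine h.trans (ent_of (fun n => Part.some n) Computable.id.partrec fun i a ha => ?_)
  exact ⟨a, Part.mem_some a, Set.mem_iInter.1 ha (y i)⟩

theorem biimpI {Γ φ ψ : I → Set ℕ}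
    (h : ∀ Δ : I → Set ℕ, Ent J Δ Γ → Ent J Δ φ → Ent J Δ ψ)
    (h' : ∀ Δ : I → Set ℕ, Ent J Δ Γ → Ent J Δ ψ → Ent J Δ φ) :
    Ent J Γ (fun i => biimp J (φ i) (ψ i)) := (impI h).and (impI h')

theorem biimp_mp {Γ φ ψ : I → Set ℕ} (h : Ent J Γ (fun i => biimp J (φ i) (ψ i)))
    (h' : Ent J Γ φ) : Ent J Γ ψ := mp (fst h) h'

theorem biimp_mpr {Γ φ ψ : I → Set ℕ} (h : Ent J Γ (fun i => biimp J (φ i) (ψ i)))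
    (h' : Ent J Γ ψ) : Ent J Γ φ := mp (snd h) h'

end Ent

end Logic

/-! ### The topos of a local operator -/

/-- Objects of the topos `Eff_J`: a set with a partial equivalence relation valued in sets of
realizers, symmetric and transitive in the sense of `J`-realizability. -/
structure Eff (J : LocalOperator) where
  carrier : Type
  eq : carrier → carrier → Set ℕ
  symm : Ent J (fun p : carrier × carrier => eq p.1 p.2) (fun p => eq p.2 p.1)
  trans : Ent J (fun p : carrier × carrier × carrier => conj (eq p.1 p.2.1) (eq p.2.1 p.2.2))
    (fun p => eq p.1 p.2.2)

namespace Eff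

variable {J : LocalOperator} {I : Type}

theorem eq_symm (X : Eff J) {Γ : I → Set ℕ} {x y : I → X.carrier}
    (h : Ent J Γ (fun i => X.eq (x i) (y i))) : Ent J Γ (fun i => X.eq (y i) (x i)) :=
  Ent.trans h (X.symm.subst fun i => (x i, y i))

theorem eq_trans (X : Eff J) {Γ : I → Set ℕ} {x y z : I → X.carrier}
    (h : Ent J Γ (fun i => X.eq (x i) (y i))) (h' : Ent J Γ (fun i => X.eq (y i) (z i))) :
    Ent J Γ (fun i => X.eq (x i) (z i)) :=
  Ent.trans (h.and h') (X.trans.subst fun i => (x i, y i, z i))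

theorem eq_left (X : Eff J) {Γ : I → Set ℕ} {x y : I → X.carrier}
    (h : Ent J Γ (fun i => X.eq (x i) (y i))) : Ent J Γ (fun i => X.eq (x i) (x i)) :=
  X.eq_trans h (X.eq_symm h)

theorem eq_right (X : Eff J) {Γ : I → Set ℕ} {x y : I → X.carrier}
    (h : Ent J Γ (fun i => X.eq (x i) (y i))) : Ent J Γ (fun i => X.eq (y i) (y i)) :=
  X.eq_trans (X.eq_symm h) h

end Eff

/-- Functional relations from `X` to `Y`: strict, extensional, single-valued and total relations
in the sense of `J`-realizability. -/
structure FunRel {J : LocalOperator} (X Y : Eff J) where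
  rel : X.carrier → Y.carrier → Set ℕ
  strict : Ent J (fun p : X.carrier × Y.carrier => rel p.1 p.2)
    (fun p => conj (X.eq p.1 p.1) (Y.eq p.2 p.2))
  cong : Ent J (fun p : (X.carrier × Y.carrier) × (X.carrier × Y.carrier) =>
      conj (rel p.1.1 p.1.2) (conj (X.eq p.1.1 p.2.1) (Y.eq p.1.2 p.2.2)))
    (fun p => rel p.2.1 p.2.2)
  single : Ent J (fun p : X.carrier × Y.carrier × Y.carrier =>
      conj (rel p.1 p.2.1) (rel p.1 p.2.2))
    (fun p => Y.eq p.2.1 p.2.2)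
  total : Ent J (fun x : X.carrier => X.eq x x) (fun x => ex (rel x))

namespace FunRel

variable {J : LocalOperator} {I : Type} {X Y Z W : Eff J}

theorem left (F : FunRel X Y) {Γ : I → Set ℕ} {x : I → X.carrier} {y : I → Y.carrier}
    (h : Ent J Γ (fun i => F.rel (x i) (y i))) : Ent J Γ (fun i => X.eq (x i) (x i)) :=
  Ent.fst (Ent.trans h (F.strict.subst fun i => (x i, y i)))

theorem right (F : FunRel X Y) {Γ : I → Set ℕ} {x : I → X.carrier} {y : I → Y.carrier}
    (h : Ent J Γ (fun i => F.rel (x i) (y i))) : Ent J Γ (fun i => Y.eq (y i) (y i)) :=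
  Ent.snd (Ent.trans h (F.strict.subst fun i => (x i, y i)))

theorem congr (F : FunRel X Y) {Γ : I → Set ℕ} {x x' : I → X.carrier} {y y' : I → Y.carrier}
    (h : Ent J Γ (fun i => F.rel (x i) (y i))) (hx : Ent J Γ (fun i => X.eq (x i) (x' i)))
    (hy : Ent J Γ (fun i => Y.eq (y i) (y' i))) : Ent J Γ (fun i => F.rel (x' i) (y' i)) :=
  Ent.trans (h.and (hx.and hy)) (F.cong.subst fun i => ((x i, y i), (x' i, y' i)))

theorem congr_left (F : FunRel X Y) {Γ : I → Set ℕ} {x x' : I → X.carrier} {y : I → Y.carrier}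
    (h : Ent J Γ (fun i => F.rel (x i) (y i))) (hx : Ent J Γ (fun i => X.eq (x i) (x' i))) :
    Ent J Γ (fun i => F.rel (x' i) (y i)) := F.congr h hx (F.right h)

theorem congr_right (F : FunRel X Y) {Γ : I → Set ℕ} {x : I → X.carrier} {y y' : I → Y.carrier}
    (h : Ent J Γ (fun i => F.rel (x i) (y i))) (hy : Ent J Γ (fun i => Y.eq (y i) (y' i))) :
    Ent J Γ (fun i => F.rel (x i) (y' i)) := F.congr h (F.left h) hy

theorem sv (F : FunRel X Y) {Γ : I → Set ℕ} {x : I → X.carrier} {y y' : I → Y.carrier}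
    (h : Ent J Γ (fun i => F.rel (x i) (y i))) (h' : Ent J Γ (fun i => F.rel (x i) (y' i))) :
    Ent J Γ (fun i => Y.eq (y i) (y' i)) :=
  Ent.trans (h.and h') (F.single.subst fun i => (x i, y i, y' i))

theorem tot (F : FunRel X Y) {Γ : I → Set ℕ} {x : I → X.carrier}
    (h : Ent J Γ (fun i => X.eq (x i) (x i))) : Ent J Γ (fun i => ex (F.rel (x i))) :=
  Ent.trans h (F.total.subst x)

/-- Functional relations `F`, `G` represent the same morphism if `F x y` and `G x y` are
equivalent. -/
instance setoid (X Y : Eff J) : Setoid (FunRel X Y) where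
  r F G := Ent J (fun p : X.carrier × Y.carrier => F.rel p.1 p.2) (fun p => G.rel p.1 p.2) ∧
    Ent J (fun p : X.carrier × Y.carrier => G.rel p.1 p.2) (fun p => F.rel p.1 p.2)
  iseqv :=
    { refl := fun _ => ⟨Ent.refl _, Ent.refl _⟩
      symm := fun h => ⟨h.2, h.1⟩
      trans := fun h h' => ⟨h.1.trans h'.1, h'.2.trans h.2⟩ }

theorem le_apply {F G : FunRel X Y}
    (h : Ent J (fun p : X.carrier × Y.carrier => F.rel p.1 p.2) (fun p => G.rel p.1 p.2))
    {Γ : I → Set ℕ} {x : I → X.carrier} {y : I → Y.carrier}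
    (h' : Ent J Γ (fun i => F.rel (x i) (y i))) : Ent J Γ (fun i => G.rel (x i) (y i)) :=
  h'.trans (h.subst fun i => (x i, y i))

/-- One of the two entailments suffices. -/
theorem equiv_of {F G : FunRel X Y}
    (h : Ent J (fun p : X.carrier × Y.carrier => F.rel p.1 p.2) (fun p => G.rel p.1 p.2)) :
    F ≈ G := by
  refine ⟨h, ?_⟩
  have h0 := Ent.refl (J := J) (fun p : X.carrier × Y.carrier => G.rel p.1 p.2)
  refine (F.tot (G.left h0)).exE fun Δ hΔ hy => ?_
  have h1 := h0.pull hΔ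
  exact F.congr_right hy (G.sv (le_apply h hy) h1)

/-- The identity: the equality of `X`. -/
def id (X : Eff J) : FunRel X X where
  rel := X.eq
  strict := (X.eq_left (Ent.refl _)).and (X.eq_right (Ent.refl _))
  cong := by
    have h := Ent.refl (J := J) (fun p : (X.carrier × X.carrier) × (X.carrier × X.carrier) =>
      conj (X.eq p.1.1 p.1.2) (conj (X.eq p.1.1 p.2.1) (X.eq p.1.2 p.2.2)))
    exact X.eq_trans (X.eq_symm h.snd.fst) (X.eq_trans h.fst h.snd.snd)
  single := by
    have h := Ent.refl (J := J) (fun p : X.carrier × X.carrier × X.carrier =>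
      conj (X.eq p.1 p.2.1) (X.eq p.1 p.2.2))
    exact X.eq_trans (X.eq_symm h.fst) h.snd
  total := Ent.exI (fun x => x) (Ent.refl _)

/-- Composition: `∃ y, F x y ∧ G y z`. -/
def comp (F : FunRel X Y) (G : FunRel Y Z) : FunRel X Z where
  rel x z := ex fun y => conj (F.rel x y) (G.rel y z)
  strict := (Ent.refl _).exE fun Δ _ h => (F.left h.fst).and (G.right h.snd)
  cong := by
    refine (Ent.refl _).fst.exE fun Δ hΔ h => ?_
    exact Ent.exI (fun i => i.2) ((F.congr_left h.fst hΔ.snd.fst).and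
      (G.congr_right h.snd hΔ.snd.snd))
  single := by
    refine (Ent.refl _).fst.exE fun Δ hΔ h => ?_
    refine hΔ.snd.exE fun Δ' hΔ' h' => ?_
    have h1 := h.pull hΔ'
    exact G.sv (G.congr_left h1.snd (F.sv h1.fst h'.fst)) h'.snd
  total := by
    refine (F.tot (Ent.refl _)).exE fun Δ hΔ h => ?_
    refine (G.tot (F.right h)).exE fun Δ' hΔ' h' => ?_
    exact Ent.exI (fun i => i.2) (Ent.exI (fun i => i.1.2) ((h.pull hΔ').and h'))

/-- The functional relation of a map between carriers that preserves equality. -/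
def ofMap (f : X.carrier → Y.carrier)
    (hf : Ent J (fun p : X.carrier × X.carrier => X.eq p.1 p.2) (fun p => Y.eq (f p.1) (f p.2))) :
    FunRel X Y where
  rel x y := conj (X.eq x x) (Y.eq (f x) y)
  strict := (Ent.refl _).fst.and (Y.eq_right (Ent.refl _).snd)
  cong := by
    have h := Ent.refl (J := J) (fun p : (X.carrier × Y.carrier) × (X.carrier × Y.carrier) =>
      conj (conj (X.eq p.1.1 p.1.1) (Y.eq (f p.1.1) p.1.2))
        (conj (X.eq p.1.1 p.2.1) (Y.eq p.1.2 p.2.2)))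
    have h1 : Ent J _ (fun p : (X.carrier × Y.carrier) × (X.carrier × Y.carrier) =>
      Y.eq (f p.1.1) (f p.2.1)) := h.snd.fst.trans
        (hf.subst fun p : (X.carrier × Y.carrier) × (X.carrier × Y.carrier) => (p.1.1, p.2.1))
    exact (X.eq_right h.snd.fst).and
      (Y.eq_trans (Y.eq_symm h1) (Y.eq_trans h.fst.snd h.snd.snd))
  single := Y.eq_trans (Y.eq_symm (Ent.refl _).fst.snd) (Ent.refl _).snd.snd
  total := by
    have h := Ent.refl (J := J) (fun x : X.carrier => X.eq x x)
    exact Ent.exI f (h.and (h.trans (hf.subst fun x => (x, x))))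

end FunRel

namespace Eff

variable {J : LocalOperator}

/-- The category `Eff_J`: morphisms are functional relations up to equivalence. -/
instance category : Category (Eff J) where
  Hom X Y := Quotient (FunRel.setoid X Y)
  id X := Quotient.mk _ (FunRel.id X)
  comp {X Y Z} f g := Quotient.map₂ FunRel.comp (by
    intro F F' hF G G' hG
    refine FunRel.equiv_of ((Ent.refl _).exE fun Δ _ h => ?_)
    exact Ent.exI (fun i => i.2) ((FunRel.le_apply hF.1 h.fst).and (FunRel.le_apply hG.1 h.snd))) f g
  id_comp {X Y} f := by
    refine Quotient.inductionOn f fun F => Quotient.sound (FunRel.equiv_of ?_)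
    exact (Ent.refl _).exE fun Δ _ h => F.congr_left h.snd (X.eq_symm h.fst)
  comp_id {X Y} f := by
    refine Quotient.inductionOn f fun F => Quotient.sound (FunRel.equiv_of ?_)
    exact (Ent.refl _).exE fun Δ _ h => F.congr_right h.fst h.snd
  assoc {W X Y Z} f g h := by
    refine Quotient.inductionOn₃ f g h fun F G H => Quotient.sound (FunRel.equiv_of ?_)
    refine (Ent.refl _).exE fun Δ _ h => h.fst.exE fun Δ' hΔ' h' => ?_
    exact Ent.exI (fun i => i.2) (h'.fst.and
      (Ent.exI (fun i => i.1.2) (h'.snd.and (h.snd.pull hΔ'))))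

/-- The morphism represented by a functional relation. -/
def homMk {X Y : Eff J} (F : FunRel X Y) : X ⟶ Y := Quotient.mk _ F

theorem homMk_surj {X Y : Eff J} (f : X ⟶ Y) : ∃ F : FunRel X Y, homMk F = f :=
  Quotient.exists_rep f

theorem homMk_comp {X Y Z : Eff J} (F : FunRel X Y) (G : FunRel Y Z) :
    homMk F ≫ homMk G = homMk (F.comp G) := rfl

theorem homMk_eq {X Y : Eff J} {F G : FunRel X Y}
    (h : Ent J (fun p : X.carrier × Y.carrier => F.rel p.1 p.2) (fun p => G.rel p.1 p.2)) :
    homMk F = homMk G := Quotient.sound (FunRel.equiv_of h)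

theorem homMk_eq_iff {X Y : Eff J} {F G : FunRel X Y} : homMk F = homMk G ↔
    Ent J (fun p : X.carrier × Y.carrier => F.rel p.1 p.2) (fun p => G.rel p.1 p.2) :=
  ⟨fun h => (Quotient.exact h).1, homMk_eq⟩

end Eff

/-! ### Finite products -/

namespace Eff

variable {J : LocalOperator} {I : Type}

/-- The terminal object. -/
def terminal (J : LocalOperator) : Eff J where
  carrier := Unit
  eq _ _ := Set.univ
  symm := Ent.refl _
  trans := (Ent.refl _).fst

theorem ent_univ {Γ : I → Set ℕ} : Ent J Γ (fun _ => Set.univ) :=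
  Ent.of_subset fun _ => Set.subset_univ _

/-- The product of two objects. -/
def prod (X Y : Eff J) : Eff J where
  carrier := X.carrier × Y.carrier
  eq p q := conj (X.eq p.1 q.1) (Y.eq p.2 q.2)
  symm := (X.eq_symm (Ent.refl _).fst).and (Y.eq_symm (Ent.refl _).snd)
  trans := (X.eq_trans (Ent.refl _).fst.fst (Ent.refl _).snd.fst).and
    (Y.eq_trans (Ent.refl _).fst.snd (Ent.refl _).snd.snd)

def terminalRel (X : Eff J) : FunRel X (terminal J) :=
  FunRel.ofMap (fun _ => ()) ent_univ

def fstRel (X Y : Eff J) : FunRel (prod X Y) X :=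
  FunRel.ofMap Prod.fst (Ent.refl _).fst

def sndRel (X Y : Eff J) : FunRel (prod X Y) Y :=
  FunRel.ofMap Prod.snd (Ent.refl _).snd

def liftRel {X Y Z : Eff J} (F : FunRel Z X) (G : FunRel Z Y) : FunRel Z (prod X Y) where
  rel z p := conj (F.rel z p.1) (G.rel z p.2)
  strict := by
    have h := Ent.refl (J := J) (fun p : Z.carrier × X.carrier × Y.carrier =>
      conj (F.rel p.1 p.2.1) (G.rel p.1 p.2.2))
    exact (F.left h.fst).and ((F.right h.fst).and (G.right h.snd))
  cong := by
    have h := Ent.refl (J := J)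
      (fun p : (Z.carrier × X.carrier × Y.carrier) × (Z.carrier × X.carrier × Y.carrier) =>
      conj (conj (F.rel p.1.1 p.1.2.1) (G.rel p.1.1 p.1.2.2))
        (conj (Z.eq p.1.1 p.2.1) (conj (X.eq p.1.2.1 p.2.2.1) (Y.eq p.1.2.2 p.2.2.2))))
    exact (F.congr h.fst.fst h.snd.fst h.snd.snd.fst).and
      (G.congr h.fst.snd h.snd.fst h.snd.snd.snd)
  single := by
    have h := Ent.refl (J := J)
      (fun p : Z.carrier × (X.carrier × Y.carrier) × (X.carrier × Y.carrier) =>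
      conj (conj (F.rel p.1 p.2.1.1) (G.rel p.1 p.2.1.2))
        (conj (F.rel p.1 p.2.2.1) (G.rel p.1 p.2.2.2)))
    exact (F.sv h.fst.fst h.snd.fst).and (G.sv h.fst.snd h.snd.snd)
  total := by
    have h := Ent.refl (J := J) (fun z : Z.carrier => Z.eq z z)
    refine (F.tot h).exE fun Δ hΔ h1 => (G.tot hΔ).exE fun Δ' hΔ' h2 => ?_
    exact Ent.exI (fun i => (i.1.2, i.2)) ((h1.pull hΔ').and h2)

theorem terminal_ext {X : Eff J} (f g : X ⟶ terminal J) : f = g := by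
  obtain ⟨F, rfl⟩ := homMk_surj f
  obtain ⟨G, rfl⟩ := homMk_surj g
  refine homMk_eq ?_
  have h := Ent.refl (J := J) (fun p : X.carrier × Unit => F.rel p.1 p.2)
  refine (G.tot (F.left h)).exE fun Δ hΔ h1 => ?_
  exact h1

theorem lift_fst {X Y Z : Eff J} (F : FunRel Z X) (G : FunRel Z Y) :
    homMk (liftRel F G) ≫ homMk (fstRel X Y) = homMk F := by
  rw [homMk_comp]
  exact homMk_eq ((Ent.refl _).exE fun Δ _ h => F.congr_right h.fst.fst h.snd.snd)

theorem lift_snd {X Y Z : Eff J} (F : FunRel Z X) (G : FunRel Z Y) :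
    homMk (liftRel F G) ≫ homMk (sndRel X Y) = homMk G := by
  rw [homMk_comp]
  exact homMk_eq ((Ent.refl _).exE fun Δ _ h => G.congr_right h.fst.snd h.snd.snd)

theorem prod_ext {X Y Z : Eff J} {f g : Z ⟶ prod X Y}
    (h1 : f ≫ homMk (fstRel X Y) = g ≫ homMk (fstRel X Y))
    (h2 : f ≫ homMk (sndRel X Y) = g ≫ homMk (sndRel X Y)) : f = g := by
  obtain ⟨F, rfl⟩ := homMk_surj f
  obtain ⟨G, rfl⟩ := homMk_surj g
  rw [homMk_comp, homMk_comp] at h1 h2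
  have k1 := homMk_eq_iff.1 h1
  have k2 := homMk_eq_iff.1 h2
  refine homMk_eq ?_
  have h := Ent.refl (J := J) (fun p : Z.carrier × X.carrier × Y.carrier => F.rel p.1 p.2)
  have hr := F.right h
  have l1 : Ent J (fun p : Z.carrier × X.carrier × Y.carrier => F.rel p.1 p.2)
      (fun p => (G.comp (fstRel X Y)).rel p.1 p.2.1) :=
    FunRel.le_apply k1 (Ent.exI (fun p => p.2) (h.and (hr.and hr.fst)))
  have l2 : Ent J (fun p : Z.carrier × X.carrier × Y.carrier => F.rel p.1 p.2)
      (fun p => (G.comp (sndRel X Y)).rel p.1 p.2.2) :=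
    FunRel.le_apply k2 (Ent.exI (fun p => p.2) (h.and (hr.and hr.snd)))
  refine Ent.exE l1 fun Δ hΔ h1 => ?_
  refine Ent.exE (l2.pull hΔ) fun Δ' hΔ' h2 => ?_
  have h1' := h1.pull hΔ'
  have e := G.sv h2.fst h1'.fst
  refine G.congr_right h1'.fst (Ent.and h1'.snd.snd (Y.eq_trans (Y.eq_symm ?_) h2.snd.snd))
  exact e.snd

/-- Finite products in `Eff_J`, given by the explicit terminal object and products above. -/
noncomputable instance cartesian : CartesianMonoidalCategory (Eff J) :=
  .ofChosenFiniteProducts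
    ⟨_, Limits.IsTerminal.ofUniqueHom (Y := terminal J) (fun X => homMk (terminalRel X))
      fun _ _ => terminal_ext _ _⟩
    fun X Y =>
    { cone := Limits.BinaryFan.mk (homMk (fstRel X Y)) (homMk (sndRel X Y))
      isLimit := Limits.BinaryFan.isLimitMk
        (fun s => homMk (liftRel (Quotient.out s.fst) (Quotient.out s.snd)))
        (fun s => (lift_fst _ _).trans (Quotient.out_eq s.fst))
        (fun s => (lift_snd _ _).trans (Quotient.out_eq s.snd))
        (fun s _ h1 h2 => prod_ext
          (h1.trans ((lift_fst _ _).trans (Quotient.out_eq s.fst)).symm)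
          (h2.trans ((lift_snd _ _).trans (Quotient.out_eq s.snd)).symm)) }

theorem tensor_eq (X Y : Eff J) : X ⊗ Y = prod X Y := rfl

theorem fst_eq (X Y : Eff J) : fst X Y = homMk (fstRel X Y) := rfl

theorem snd_eq (X Y : Eff J) : snd X Y = homMk (sndRel X Y) := rfl

end Eff

/-! ### Exponentials -/

/-- The set of realizers of "`R` is a functional relation from `X` to `Y`". -/
def isFun {J : LocalOperator} (X Y : Eff J) (R : X.carrier → Y.carrier → Set ℕ) : Set ℕ :=
  conj (all J fun p : X.carrier × Y.carrier =>
      imp J (R p.1 p.2) (conj (X.eq p.1 p.1) (Y.eq p.2 p.2))) <|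
  conj (all J fun p : (X.carrier × Y.carrier) × (X.carrier × Y.carrier) =>
      imp J (conj (R p.1.1 p.1.2) (conj (X.eq p.1.1 p.2.1) (Y.eq p.1.2 p.2.2)))
        (R p.2.1 p.2.2)) <|
  conj (all J fun p : X.carrier × Y.carrier × Y.carrier =>
      imp J (conj (R p.1 p.2.1) (R p.1 p.2.2)) (Y.eq p.2.1 p.2.2))
    (all J fun x : X.carrier => imp J (X.eq x x) (ex (R x)))

/-- The set of realizers of "`R` and `S` are equivalent relations". -/
def relEquiv (J : LocalOperator) {X Y : Type} (R S : X → Y → Set ℕ) : Set ℕ :=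
  all J fun p : X × Y => biimp J (R p.1 p.2) (S p.1 p.2)

namespace Eff

variable {J : LocalOperator} {I : Type} {A X Y Z : Eff J}

section Relations

variable {Γ : I → Set ℕ} {R S T : I → A.carrier → Y.carrier → Set ℕ}
  {a a' : I → A.carrier} {y y' : I → Y.carrier}

theorem isFun_strict (h : Ent J Γ (fun i => isFun A Y (R i)))
    (h' : Ent J Γ (fun i => R i (a i) (y i))) :
    Ent J Γ (fun i => conj (A.eq (a i) (a i)) (Y.eq (y i) (y i))) :=
  (h.fst.allE (fun i => (a i, y i))).mp h'

theorem isFun_congr (h : Ent J Γ (fun i => isFun A Y (R i)))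
    (h' : Ent J Γ (fun i => R i (a i) (y i))) (ha : Ent J Γ (fun i => A.eq (a i) (a' i)))
    (hy : Ent J Γ (fun i => Y.eq (y i) (y' i))) : Ent J Γ (fun i => R i (a' i) (y' i)) :=
  (h.snd.fst.allE (fun i => ((a i, y i), (a' i, y' i)))).mp (h'.and (ha.and hy))

theorem isFun_sv (h : Ent J Γ (fun i => isFun A Y (R i)))
    (h1 : Ent J Γ (fun i => R i (a i) (y i))) (h2 : Ent J Γ (fun i => R i (a i) (y' i))) :
    Ent J Γ (fun i => Y.eq (y i) (y' i)) :=
  (h.snd.snd.fst.allE (fun i => (a i, y i, y' i))).mp (h1.and h2)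

theorem isFun_tot (h : Ent J Γ (fun i => isFun A Y (R i)))
    (h' : Ent J Γ (fun i => A.eq (a i) (a i))) : Ent J Γ (fun i => ex (R i (a i))) :=
  (h.snd.snd.snd.allE a).mp h'

theorem relEquiv_mp (h : Ent J Γ (fun i => relEquiv J (R i) (S i)))
    (h' : Ent J Γ (fun i => R i (a i) (y i))) : Ent J Γ (fun i => S i (a i) (y i)) :=
  (h.allE (fun i => (a i, y i))).biimp_mp h'

theorem relEquiv_mpr (h : Ent J Γ (fun i => relEquiv J (R i) (S i)))
    (h' : Ent J Γ (fun i => S i (a i) (y i))) : Ent J Γ (fun i => R i (a i) (y i)) :=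
  (h.allE (fun i => (a i, y i))).biimp_mpr h'

theorem relEquiv_symm (h : Ent J Γ (fun i => relEquiv J (R i) (S i))) :
    Ent J Γ (fun i => relEquiv J (S i) (R i)) := by
  have h1 : Ent J (fun p : I × A.carrier × Y.carrier => Γ p.1)
    (fun p => relEquiv J (R p.1) (S p.1)) := h.subst Prod.fst
  exact Ent.allI (Ent.biimpI (fun Δ hΔ k => relEquiv_mpr (h1.pull (f := fun p => p) hΔ) k)
    (fun Δ hΔ k => relEquiv_mp (h1.pull (f := fun p => p) hΔ) k))

theorem relEquiv_trans (h : Ent J Γ (fun i => relEquiv J (R i) (S i)))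
    (h' : Ent J Γ (fun i => relEquiv J (S i) (T i))) :
    Ent J Γ (fun i => relEquiv J (R i) (T i)) := by
  have h1 : Ent J (fun p : I × A.carrier × Y.carrier => Γ p.1)
    (fun p => relEquiv J (R p.1) (S p.1)) := h.subst Prod.fst
  have h2 : Ent J (fun p : I × A.carrier × Y.carrier => Γ p.1)
    (fun p => relEquiv J (S p.1) (T p.1)) := h'.subst Prod.fst
  exact Ent.allI (Ent.biimpI
    (fun Δ hΔ k => relEquiv_mp (h2.pull (f := fun p => p) hΔ)
      (relEquiv_mp (h1.pull (f := fun p => p) hΔ) k))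
    (fun Δ hΔ k => relEquiv_mpr (h1.pull (f := fun p => p) hΔ)
      (relEquiv_mpr (h2.pull (f := fun p => p) hΔ) k)))

end Relations

/-- The exponential `Y ^ A`: relations from `A` to `Y`, equal if they are functional and
equivalent. -/
def expo (A Y : Eff J) : Eff J where
  carrier := A.carrier → Y.carrier → Set ℕ
  eq R S := conj (isFun A Y R) (conj (isFun A Y S) (relEquiv J R S))
  symm := (Ent.refl _).snd.fst.and ((Ent.refl _).fst.and (relEquiv_symm (Ent.refl _).snd.snd))
  trans := (Ent.refl _).fst.fst.and ((Ent.refl _).snd.snd.fst.and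
    (relEquiv_trans (Ent.refl _).fst.snd.snd (Ent.refl _).snd.snd.snd))

theorem isFun_of_rel (F : FunRel (prod A X) Y) {Γ : I → Set ℕ} {x : I → X.carrier}
    (h : Ent J Γ (fun i => X.eq (x i) (x i))) :
    Ent J Γ (fun i => isFun A Y fun a y => F.rel (a, x i) y) := by
  refine Ent.and (Ent.allI (Ent.impI fun Δ hΔ k => ?_)) <|
    Ent.and (Ent.allI (Ent.impI fun Δ hΔ k => ?_)) <|
    Ent.and (Ent.allI (Ent.impI fun Δ hΔ k => ?_)) (Ent.allI (Ent.impI fun Δ hΔ k => ?_))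
  · exact Ent.and (F.left k).fst (F.right k)
  · exact F.congr k.fst (Ent.and k.snd.fst (h.pull hΔ)) k.snd.snd
  · exact F.sv k.fst k.snd
  · exact F.tot (Ent.and k (h.pull hΔ))

/-- Transposition of functional relations. -/
def curryRel (F : FunRel (prod A X) Y) : FunRel X (expo A Y) where
  rel x R := conj (X.eq x x) (conj (isFun A Y R) (relEquiv J R fun a y => F.rel (a, x) y))
  strict := by
    have h := Ent.refl (J := J) (fun p : X.carrier × (A.carrier → Y.carrier → Set ℕ) =>
      conj (X.eq p.1 p.1) (conj (isFun A Y p.2) (relEquiv J p.2 fun a y => F.rel (a, p.1) y)))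
    exact h.fst.and (h.snd.fst.and (h.snd.fst.and
      (relEquiv_trans h.snd.snd (relEquiv_symm h.snd.snd))))
  cong := by
    have h := Ent.refl (J := J) (fun p : (X.carrier × (A.carrier → Y.carrier → Set ℕ)) ×
        (X.carrier × (A.carrier → Y.carrier → Set ℕ)) =>
      conj (conj (X.eq p.1.1 p.1.1) (conj (isFun A Y p.1.2)
        (relEquiv J p.1.2 fun a y => F.rel (a, p.1.1) y)))
        (conj (X.eq p.1.1 p.2.1) ((expo A Y).eq p.1.2 p.2.2)))
    have hx := h.snd.fst
    refine Ent.and (X.eq_right hx) (Ent.and h.snd.snd.snd.fst ?_)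
    refine relEquiv_trans (relEquiv_symm h.snd.snd.snd.snd) (relEquiv_trans h.fst.snd.snd ?_)
    refine Ent.allI (Ent.biimpI (fun Δ hΔ k => ?_) (fun Δ hΔ k => ?_))
    · exact F.congr_left k (Ent.and (F.left k).fst (hx.pull hΔ))
    · exact F.congr_left k (Ent.and (F.left k).fst (X.eq_symm (hx.pull hΔ)))
  single := (Ent.refl _).fst.snd.fst.and ((Ent.refl _).snd.snd.fst.and
    (relEquiv_trans (Ent.refl _).fst.snd.snd (relEquiv_symm (Ent.refl _).snd.snd.snd)))
  total := by
    refine Ent.exI (fun x a y => F.rel (a, x) y) ((Ent.refl _).and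
      ((isFun_of_rel F (Ent.refl _)).and ?_))
    exact Ent.allI (Ent.biimpI (fun Δ hΔ k => k) (fun Δ hΔ k => k))

/-- Transposition of functional relations. -/
def uncurryRel (G : FunRel X (expo A Y)) : FunRel (prod A X) Y where
  rel p y := ex fun R => conj (G.rel p.2 R) (R p.1 y)
  strict := by
    refine (Ent.refl _).exE fun Δ _ h => ?_
    have hs := isFun_strict (G.right h.fst).fst h.snd
    exact Ent.and (Ent.and hs.fst (G.left h.fst)) hs.snd
  cong := by
    refine (Ent.refl _).fst.exE fun Δ hΔ h => ?_
    refine Ent.exI (fun i => i.2) (Ent.and (G.congr_left h.fst hΔ.snd.fst.snd) ?_)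
    exact isFun_congr (G.right h.fst).fst h.snd hΔ.snd.fst.fst hΔ.snd.snd
  single := by
    refine (Ent.refl _).fst.exE fun Δ hΔ h => ?_
    refine hΔ.snd.exE fun Δ' hΔ' h' => ?_
    have h1 := h.pull hΔ'
    have e := G.sv h1.fst h'.fst
    exact isFun_sv e.snd.fst (relEquiv_mp e.snd.snd h1.snd) h'.snd
  total := by
    have h0 := Ent.refl (J := J) (fun p : A.carrier × X.carrier => (prod A X).eq p p)
    refine (G.tot h0.snd).exE fun Δ hΔ h => ?_
    refine (isFun_tot (G.right h).fst hΔ.fst).exE fun Δ' hΔ' h' => ?_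
    exact Ent.exI (fun i => i.2) (Ent.exI (fun i => i.1.2) ((h.pull hΔ').and h'))

theorem curryRel_congr {F F' : FunRel (prod A X) Y} (h : F ≈ F') : curryRel F ≈ curryRel F' := by
  refine FunRel.equiv_of ?_
  have h0 := Ent.refl (J := J) (fun p : X.carrier × (A.carrier → Y.carrier → Set ℕ) =>
    (curryRel F).rel p.1 p.2)
  refine h0.fst.and (h0.snd.fst.and (relEquiv_trans h0.snd.snd ?_))
  exact Ent.allI (Ent.biimpI (fun Δ hΔ k => FunRel.le_apply h.1 k)
    (fun Δ hΔ k => FunRel.le_apply h.2 k))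

theorem uncurryRel_congr {G G' : FunRel X (expo A Y)} (h : G ≈ G') :
    uncurryRel G ≈ uncurryRel G' := by
  refine FunRel.equiv_of ((Ent.refl _).exE fun Δ _ k => ?_)
  exact Ent.exI (fun i => i.2) (Ent.and (FunRel.le_apply h.1 k.fst) k.snd)

theorem uncurry_curry (F : FunRel (prod A X) Y) : uncurryRel (curryRel F) ≈ F := by
  refine FunRel.equiv_of ((Ent.refl _).exE fun Δ _ k => ?_)
  have k1 : Ent J Δ (fun i => (curryRel F).rel i.1.1.2 i.2) := k.fst
  have k2 : Ent J Δ (fun i => i.2 i.1.1.1 i.1.2) := k.snd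
  have k3 : Ent J Δ (fun i => relEquiv J i.2 fun a y => F.rel (a, i.1.1.2) y) := k1.snd.snd
  exact (k3.allE (fun i => (i.1.1.1, i.1.2))).biimp_mp k2

theorem curry_uncurry (G : FunRel X (expo A Y)) : curryRel (uncurryRel G) ≈ G := by
  symm
  refine FunRel.equiv_of ?_
  have h := Ent.refl (J := J) (fun p : X.carrier × (A.carrier → Y.carrier → Set ℕ) =>
    G.rel p.1 p.2)
  refine Ent.and (G.left h) (Ent.and (G.right h).fst ?_)
  refine Ent.allI (Ent.biimpI (fun Δ hΔ k => ?_) (fun Δ hΔ k => ?_))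
  · exact Ent.exI (fun p => p.1.2) (Ent.and (h.pull hΔ) k)
  · refine Ent.exE k fun Δ' hΔ' k' => ?_
    have e := G.sv k'.fst (h.pull (hΔ.pull hΔ'))
    exact relEquiv_mp e.snd.snd k'.snd

/-- Morphisms `A ⊗ X ⟶ Y` correspond to morphisms `X ⟶ Y ^ A`. -/
noncomputable def curryEquiv (A X Y : Eff J) : (A ⊗ X ⟶ Y) ≃ (X ⟶ expo A Y) where
  toFun := Quotient.map curryRel fun _ _ h => curryRel_congr h
  invFun := Quotient.map uncurryRel fun _ _ h => uncurryRel_congr h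
  left_inv f := Quotient.inductionOn f fun F => Quotient.sound (uncurry_curry F)
  right_inv f := Quotient.inductionOn f fun G => Quotient.sound (curry_uncurry G)

theorem whisker_eq (A : Eff J) (F : FunRel X Y) :
    A ◁ homMk F = homMk (liftRel (fstRel A X) ((sndRel A X).comp F)) := by
  refine prod_ext ?_ ?_
  · exact (whiskerLeft_fst A (homMk F)).trans (lift_fst _ _).symm
  · exact (whiskerLeft_snd A (homMk F)).trans (lift_snd _ _).symm

theorem curry_natural (A : Eff J) (f : X ⟶ Y) (g : A ⊗ Y ⟶ Z) :
    curryEquiv A X Z (A ◁ f ≫ g) = f ≫ curryEquiv A Y Z g := by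
  obtain ⟨F, rfl⟩ := homMk_surj f
  obtain ⟨G, rfl⟩ := homMk_surj g
  rw [← Equiv.eq_symm_apply, whisker_eq]
  refine Quotient.sound (Setoid.symm (FunRel.equiv_of ?_))
  refine (Ent.refl _).exE fun Δ _ k => k.fst.exE fun Δ' hΔ' k' => ?_
  have hR := k.snd.pull hΔ'
  have hG := relEquiv_mp k'.snd.snd.snd hR
  refine Ent.exI (fun i => (i.1.1.1.1, i.2)) (Ent.and (Ent.and ?_ ?_) hG)
  · exact Ent.and (Ent.and (G.left hG).fst (F.left k'.fst)) (G.left hG).fst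
  · exact Ent.exI (fun i => i.1.1.1.2) (Ent.and (Ent.and (Ent.and (G.left hG).fst
      (F.left k'.fst)) (F.left k'.fst)) k'.fst)

/-- `Eff_J` is cartesian closed, with the explicit exponentials above. -/
noncomputable instance closed : MonoidalClosed (Eff J) where
  closed A :=
    { rightAdj := _
      adj := Adjunction.adjunctionOfEquivRight (F := tensorLeft A) (G_obj := expo A)
        (fun X Y => curryEquiv A X Y) fun _ _ _ f g => curry_natural A f g }

end Eff

/-! ### The objects `Ω`, `N` and `𝒩`, subquotients, and the map `X ⟶ X ^ A` -/

/-- The subobject classifier `Ω = (P(ℕ), =)` with `[A = B] = (A → J B) ∧ (B → J A)`. -/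
def omega (J : LocalOperator) : Eff J where
  carrier := Set ℕ
  eq A B := conj (arr A (J B)) (arr B (J A))
  symm := Ent.and (Ent.refl _).snd (Ent.refl _).fst
  trans := by
    have h := Ent.refl (J := J) (fun p : Set ℕ × Set ℕ × Set ℕ =>
      conj (biimp J p.1 p.2.1) (biimp J p.2.1 p.2.2))
    exact Ent.biimpI (fun Δ hΔ k => (h.snd.pull (f := fun p => p) hΔ).biimp_mp
        ((h.fst.pull (f := fun p => p) hΔ).biimp_mp k))
      (fun Δ hΔ k => (h.fst.pull (f := fun p => p) hΔ).biimp_mpr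
        ((h.snd.pull (f := fun p => p) hΔ).biimp_mpr k))

/-- The object of `Eff_J` given by a `J`-assembly `(X, E)`: `[x = y]` is `E x` if `x = y` and
empty otherwise. -/
def assembly (J : LocalOperator) (X : Type) (E : X → Set ℕ) : Eff J where
  carrier := X
  eq x y := {n | x = y ∧ n ∈ E x}
  symm := Ent.of_subset fun p n h => ⟨h.1.symm, h.1 ▸ h.2⟩
  trans := by
    obtain ⟨r, hr, hr'⟩ := exists_ret J
    refine ent_of (fun n => r n.unpair.1) (hr.comp (Computable.fst.comp Computable.unpair)) ?_
    intro p n hn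
    obtain ⟨h1, h2⟩ := mem_conj.1 hn
    exact hr' _ _ ⟨h1.1.trans h2.1, h1.2⟩

/-- The natural numbers object `N = (ℕ, {·})`. -/
def nat (J : LocalOperator) : Eff J := assembly J ℕ fun n => {n}

/-- Function symbols of the language of arithmetic. -/
inductive ArithFunc : ℕ → Type
  | zero : ArithFunc 0
  | succ : ArithFunc 1
  | add : ArithFunc 2
  | mul : ArithFunc 2

/-- The first-order language `0, S, +, ·` of arithmetic. -/
def arithmetic : FirstOrder.Language := ⟨ArithFunc, fun _ => Empty⟩

/-- The standard model. -/
instance standardModel : arithmetic.Structure ℕ where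
  funMap f v :=
    match f, v with
    | ArithFunc.zero, _ => 0
    | ArithFunc.succ, v => v 0 + 1
    | ArithFunc.add, v => v 0 + v 1
    | ArithFunc.mul, v => v 0 * v 1
  RelMap r := r.elim

/-- A function is arithmetical if its graph is definable in the standard model. -/
def Arithmetical (f : ℕ → ℕ) : Prop :=
  (∅ : Set ℕ).Definable₂ arithmetic {p : ℕ × ℕ | p.2 = f p.1}

/-- The indices of total recursive functions that `J`-represent `f`. -/
def representers (J : LocalOperator) (f : ℕ → ℕ) : Set ℕ :=
  {e | ∀ n, ∃ m ∈ app e n, m ∈ J {f n}}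

/-- Arithmetical functions `α`, `β` are equivalent along `ψ` if `α (ψ n) = β (ψ n)` for all
sufficiently large `n`. -/
def eventuallyEq (ψ : ℕ → ℕ) : Setoid {f : ℕ → ℕ // Arithmetical f} where
  r α β := ∀ᶠ n in Filter.atTop, α.1 (ψ n) = β.1 (ψ n)
  iseqv :=
    { refl := fun _ => Filter.Eventually.of_forall fun _ => rfl
      symm := fun h => h.mono fun _ h => h.symm
      trans := fun h h' => (h.and h').mono fun _ h => h.1.trans h.2 }

/-- The object `𝒩` attached to `ψ`: its underlying set is the set of arithmetical functions
modulo equality along `ψ`, and `E [α]` consists of the representers of all `β ∘ ψ` with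
`β ∈ [α]`. -/
def skolem (J : LocalOperator) (ψ : ℕ → ℕ) : Eff J :=
  assembly J (Quotient (eventuallyEq ψ)) fun q =>
    {e | ∃ β : {f : ℕ → ℕ // Arithmetical f},
      Quotient.mk (eventuallyEq ψ) β = q ∧ e ∈ representers J (β.1 ∘ ψ)}

/-- `X` is a subquotient of `Y`: a quotient of a subobject of `Y`. -/
def IsSubquotient {C : Type*} [Category C] (X Y : C) : Prop :=
  ∃ (S : C) (m : S ⟶ Y) (q : S ⟶ X), Mono m ∧ Epi q

/-- The natural map `X ⟶ X ^ A`, the transpose of the projection `A × X ⟶ X`. -/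
def constMap {C : Type*} [Category C] [CartesianMonoidalCategory C] [MonoidalClosed C]
    (A X : C) : X ⟶ (ihom A).obj X :=
  MonoidalClosed.curry (snd A X)

end JRealizability

open JRealizability

namespace JRealizability

open Eff

/-! ### Pitts' operator and intersections -/

/-! Two facts force every function out of `Ω` to be constant. First, all elements of `Ω` exist by
virtue of one and the same realizer, so a realizer of the totality of a functional relation `R` from
`Ω` to `X` produces a single number that belongs to `J (∃ x, R p x)` for every `p` at once. Second,
Pitts' operator satisfies `J A ∩ J B ⊆ J (A ∩ B)` with the same number on both sides
(`leastLocal_pittsF_inter`). Hence, for any two `p` and `p'`, that number belongs to `J` of the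
intersection of the two existential statements.

Suppose now that each `x` has a set `T x` of names, computed from a realizer of its existence, and
that a common name of `x` and `x'` yields a realizer of `x = x'`. Attaching a name to the value of
`R`, the intersection provides `x` and `x'` with a common name such that `R p x` and `R p' x'`; so
`R` takes equal values at `p` and `p'` (`exists_common_value`). This gives surjectivity of `X ⟶ X ^
Ω`, and injectivity holds because `Ω` has a global element (`isIso_constMap_of_names`).

In a subquotient of `N` a name of `x` carries a numeral that represents `x`. In an assembly with
pairwise disjoint sets of realizers, such as `N` or `𝒩`, the realizers are names. Function objects
are covered by a general fact on cartesian closed categories: if `X ⟶ X ^ A` is invertible, so is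
the corresponding map for `X ^ B` (`isIso_constMap_ihom`). -/

theorem zero_mem_pitts {A : Set ℕ} {a : ℕ} (h : Nat.pair 0 a ∈ leastLocal pittsF A) : a ∈ A := by
  have := @pitts_ind A {x | x.unpair.1 = 0 → x.unpair.2 ∈ A} (by simp) (by simp) _ h
  simpa using this

theorem one_mem_pitts {A : Set ℕ} {f : ℕ} (h : Nat.pair 1 f ∈ leastLocal pittsF A) :
    f ∈ pittsF (leastLocal pittsF A) := by
  have := @pitts_ind A
    -- Membership in `leastLocal pittsF A` is carried along in the induction, so that monotonicity
    -- of `pittsF` turns the induction hypothesis on `g` into the required one.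
    {x | x ∈ leastLocal pittsF A ∧ (x.unpair.1 = 1 → x.unpair.2 ∈ pittsF (leastLocal pittsF A))}
    (fun a ha => ⟨leastLocal_zero ha, by simp⟩)
    (fun g hg => by
      have hg' := pittsF_mono (fun _ h => h.1) hg
      exact ⟨pitts_one hg', by simpa using hg'⟩) _ h
  simpa using this.2

/-- An element of `leastLocal pittsF A` is a code of a well-founded tree with leaves in `A`, and its
tag, 0 or 1, tells leaves from nodes. A common element is thus a leaf, or a node, for both sets. At
a node the two conditions concern the same partial function, so beyond the larger of the two
thresholds its unique value satisfies both. -/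
theorem leastLocal_pittsF_inter (A B : Set ℕ) :
    leastLocal pittsF A ∩ leastLocal pittsF B ⊆ leastLocal pittsF (A ∩ B) := by
  rintro x ⟨hA, hB⟩
  refine @pitts_ind A {x | x ∈ leastLocal pittsF B → x ∈ leastLocal pittsF (A ∩ B)} ?_ ?_ x hA hB
  · exact fun a ha h => leastLocal_zero ⟨ha, zero_mem_pitts h⟩
  · intro f hf h
    obtain ⟨m, hm⟩ := Set.mem_iUnion.1 hf
    obtain ⟨n, hn⟩ := Set.mem_iUnion.1 (one_mem_pitts h)
    refine pitts_one (Set.mem_iUnion.2 ⟨max m n, fun k hk => ?_⟩)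
    obtain ⟨b, hb, hb'⟩ := hm k (Set.mem_Ici.2 (le_of_max_le_left hk))
    obtain ⟨c, hc, hc'⟩ := hn k (Set.mem_Ici.2 (le_of_max_le_right hk))
    obtain rfl := Part.mem_unique hb hc
    exact ⟨b, hb, hb' hc'⟩

/-- A realizer that does not depend on a parameter realizes the intersection of any two of its
instances. -/
theorem Ent.inter {I P : Type*} {Γ : I → Set ℕ} {φ : I → P → Set ℕ}
    (h : Ent pitts (fun q : I × P => Γ q.1) (fun q => φ q.1 q.2)) (p p' : I → P) :
    Ent pitts Γ (fun i => φ i (p i) ∩ φ i (p' i)) := by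
  obtain ⟨e, he⟩ := ent_iff.1 h
  refine ent_iff.2 ⟨e, fun i a ha => ?_⟩
  obtain ⟨b, hb, hb'⟩ := he (i, p i) a ha
  obtain ⟨c, hc, hc'⟩ := he (i, p' i) a ha
  obtain rfl := Part.mem_unique hb hc
  exact ⟨b, hb, leastLocal_pittsF_inter _ _ ⟨hb', hc'⟩⟩

/-! ### Monomorphisms, epimorphisms and isomorphisms in the internal logic -/

section Internal

variable {J : LocalOperator} {X Y : Eff J}

/-- The inverse of a functional relation that is internally injective and surjective. -/
def FunRel.converse (F : FunRel X Y)
    (inj : Ent J (fun p : Y.carrier × X.carrier × X.carrier =>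
      conj (F.rel p.2.1 p.1) (F.rel p.2.2 p.1)) (fun p => X.eq p.2.1 p.2.2))
    (surj : Ent J (fun y : Y.carrier => Y.eq y y) (fun y => ex fun x => F.rel x y)) :
    FunRel Y X where
  rel y x := F.rel x y
  strict := Ent.and (F.right (Ent.refl _)) (F.left (Ent.refl _))
  cong := F.congr (Ent.refl _).fst (Ent.refl _).snd.snd (Ent.refl _).snd.fst
  single := inj
  total := surj

/-- The converse relation is functional under these hypotheses, and it represents the inverse. -/
theorem isIso_homMk (F : FunRel X Y)
    (inj : Ent J (fun p : Y.carrier × X.carrier × X.carrier =>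
      conj (F.rel p.2.1 p.1) (F.rel p.2.2 p.1)) (fun p => X.eq p.2.1 p.2.2))
    (surj : Ent J (fun y : Y.carrier => Y.eq y y) (fun y => ex fun x => F.rel x y)) :
    IsIso (homMk F) := by
  refine ⟨homMk (F.converse inj surj), ?_, ?_⟩
  · exact homMk_eq ((Ent.refl _).exE fun Δ _ h =>
      h.trans (inj.subst fun i : (X.carrier × X.carrier) × Y.carrier => (i.2, i.1.1, i.1.2)))
  · exact homMk_eq ((Ent.refl _).exE fun Δ _ h => F.sv h.fst h.snd)

/-- The kernel pair of a functional relation. -/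
def kernelPair (F : FunRel X Y) : Eff J where
  carrier := X.carrier × X.carrier
  eq p q := conj (conj (X.eq p.1 q.1) (X.eq p.2 q.2)) (ex fun y => conj (F.rel p.1 y) (F.rel p.2 y))
  symm := by
    have h := Ent.refl (J := J) (fun p : (X.carrier × X.carrier) × (X.carrier × X.carrier) =>
      conj (conj (X.eq p.1.1 p.2.1) (X.eq p.1.2 p.2.2))
        (ex fun y => conj (F.rel p.1.1 y) (F.rel p.1.2 y)))
    refine Ent.and (Ent.and (X.eq_symm h.fst.fst) (X.eq_symm h.fst.snd)) ?_
    refine h.snd.exE fun Δ hΔ k => Ent.exI (fun i => i.2) ?_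
    exact (F.congr_left k.fst hΔ.fst.fst).and (F.congr_left k.snd hΔ.fst.snd)
  trans := Ent.and (Ent.and (X.eq_trans (Ent.refl _).fst.fst.fst (Ent.refl _).snd.fst.fst)
    (X.eq_trans (Ent.refl _).fst.fst.snd (Ent.refl _).snd.fst.snd)) (Ent.refl _).fst.snd

/-- The two projections from the kernel pair agree after composition with `F`, hence are equal. The
first projection sends `(x, x')` to `x`; so does the second, whence `x' = x`. -/
theorem injective_of_mono (F : FunRel X Y) [Mono (homMk F)] :
    Ent J (fun p : Y.carrier × X.carrier × X.carrier =>
      conj (F.rel p.2.1 p.1) (F.rel p.2.2 p.1)) (fun p => X.eq p.2.1 p.2.2) := by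
  let p₁ : FunRel (kernelPair F) X := FunRel.ofMap Prod.fst (Ent.refl _).fst.fst
  let p₂ : FunRel (kernelPair F) X := FunRel.ofMap Prod.snd (Ent.refl _).fst.snd
  have e : homMk p₁ ≫ homMk F = homMk p₂ ≫ homMk F := by
    refine homMk_eq ((Ent.refl _).exE fun Δ _ h => ?_)
    refine Ent.exE h.fst.fst.snd fun Δ' hΔ' k => ?_
    have h1 := h.pull hΔ'
    have e1 := F.sv (F.congr_left k.fst h1.fst.snd) h1.snd
    exact Ent.exI (fun i => i.1.1.1.2) (Ent.and (Ent.and h1.fst.fst (F.left k.snd))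
      (F.congr_right k.snd e1))
  have e' := homMk_eq_iff.1 ((cancel_mono (homMk F)).1 e)
  have h := Ent.refl (J := J) (fun p : Y.carrier × X.carrier × X.carrier =>
    conj (F.rel p.2.1 p.1) (F.rel p.2.2 p.1))
  have l := F.left h.fst
  have r := F.left h.snd
  refine X.eq_symm (Ent.snd (FunRel.le_apply e'
    (x := fun p : Y.carrier × X.carrier × X.carrier => p.2) (y := fun p => p.2.1) ?_))
  exact Ent.and (Ent.and (Ent.and l r) (Ent.exI (fun p => p.1) h)) l

/-- The characteristic map of the image of `F` and the constant map "true" from `Y` to `Ω` agree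
after composition with `F`. For an epimorphism they are equal, so every element of `Y` is in the
image. -/
theorem surjective_of_epi (F : FunRel X Y) [Epi (homMk F)] :
    Ent J (fun y : Y.carrier => Y.eq y y) (fun y => ex fun x => F.rel x y) := by
  let g₁ : FunRel Y (omega J) := FunRel.ofMap (fun _ => Set.univ)
    (Ent.biimpI (fun _ _ k => k) (fun _ _ k => k))
  let g₂ : FunRel Y (omega J) := FunRel.ofMap (fun y => ex fun x => F.rel x y)
    (Ent.biimpI
      (fun Δ hΔ k => k.exE fun Δ' hΔ' k' =>
        Ent.exI (fun i => i.2) (F.congr_right k' (hΔ.pull hΔ')))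
      (fun Δ hΔ k => k.exE fun Δ' hΔ' k' =>
        Ent.exI (fun i => i.2) (F.congr_right k' (Y.eq_symm (hΔ.pull hΔ')))))
  have e : homMk F ≫ homMk g₁ = homMk F ≫ homMk g₂ := by
    refine homMk_eq ((Ent.refl _).exE fun Δ _ h => ?_)
    refine Ent.exI (fun i => i.2) (Ent.and h.fst (Ent.and h.snd.fst ?_))
    refine (omega J).eq_trans (y := fun _ => Set.univ) ?_ h.snd.snd
    exact Ent.biimpI (fun _ _ _ => ent_univ)
      (fun Δ hΔ _ => Ent.exI (fun i => i.1.1) (h.fst.pull (f := fun i => i) hΔ))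
  have e' := homMk_eq_iff.1 ((cancel_epi (homMk F)).1 e)
  have h := Ent.refl (J := J) (fun y : Y.carrier => Y.eq y y)
  have h2 := Ent.snd (FunRel.le_apply e' (x := fun y => y) (y := fun _ => Set.univ)
    (h.and (Ent.biimpI (fun _ _ k => k) (fun _ _ k => k))))
  exact h2.biimp_mpr ent_univ

end Internal

/-! ### The uniformity principle -/

theorem adjunctionOfEquivRight_homEquiv {C D : Type*} [Category C] [Category D] {F : C ⥤ D}
    {G : D → C} (e : ∀ X Y, (F.obj X ⟶ Y) ≃ (X ⟶ G Y))
    (he : ∀ X' X Y f g, e X' Y (F.map f ≫ g) = f ≫ e X Y g) (X : C) (Y : D) :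
    (Adjunction.adjunctionOfEquivRight e he).homEquiv X Y = e X Y :=
  congrFun (congrFun (Adjunction.mkOfHomEquiv_homEquiv _) X) Y

/-- The hom-set bijection of the chosen adjunction is `curryEquiv`, which gives an explicit relation
to compute with. -/
theorem constMap_eq {J : LocalOperator} (A X : Eff J) :
    constMap A X = homMk (curryRel (sndRel A X)) :=
  congrArg (fun e : (A ⊗ X ⟶ X) ≃ (X ⟶ expo A X) => e (snd A X))
    (adjunctionOfEquivRight_homEquiv (F := tensorLeft A) (G := expo A) (curryEquiv A)
      (fun _ _ _ f g => curry_natural A f g) X X)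

section Uniformity

variable {J : LocalOperator} {I : Type}

/-- This is the uniformity of `Ω`: the context `Γ` need not contain any information on `p`. -/
theorem omega_refl {Γ : I → Set ℕ} (p : I → Set ℕ) :
    Ent J Γ (fun i => (omega J).eq (p i) (p i)) :=
  Ent.biimpI (fun _ _ k => k) (fun _ _ k => k)

/-- Both constant functions are evaluated at the global element `∅` of `Ω`. -/
theorem constRel_injective {X : Eff J} :
    Ent J (fun p : (Set ℕ → X.carrier → Set ℕ) × X.carrier × X.carrier =>
      conj ((curryRel (sndRel (omega J) X)).rel p.2.1 p.1)
        ((curryRel (sndRel (omega J) X)).rel p.2.2 p.1)) (fun p => X.eq p.2.1 p.2.2) := by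
  have h := Ent.refl (J := J) (fun p : (Set ℕ → X.carrier → Set ℕ) × X.carrier × X.carrier =>
      conj ((curryRel (sndRel (omega J) X)).rel p.2.1 p.1)
        ((curryRel (sndRel (omega J) X)).rel p.2.2 p.1))
  have h1 : Ent J _ (fun p : (Set ℕ → X.carrier → Set ℕ) × X.carrier × X.carrier =>
    X.eq p.2.1 p.2.1) := h.fst.fst
  have h2 := (h.fst.snd.snd.allE (fun p => ((∅ : Set ℕ), p.2.1))).biimp_mpr
    (((omega_refl _).and h1).and h1)
  have h3 := (h.snd.snd.snd.allE (fun p => ((∅ : Set ℕ), p.2.1))).biimp_mp h2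
  exact X.eq_symm h3.snd

variable {X : Eff pitts} {T : X.carrier → Set ℕ}

/-- The values of a function on `Ω` at two arguments coincide if elements have names. -/
theorem exists_common_value
    (hT : Ent pitts (fun x : X.carrier => X.eq x x) T)
    (hT' : Ent pitts (fun p : X.carrier × X.carrier => T p.1 ∩ T p.2) (fun p => X.eq p.1 p.2))
    {Γ : I → Set ℕ} {R : I → Set ℕ → X.carrier → Set ℕ}
    (hR : Ent pitts Γ (fun i => isFun (omega pitts) X (R i))) (p p' : I → Set ℕ) :
    Ent pitts Γ (fun i => ex fun x => conj (R i (p i) x) (R i (p' i) x)) := by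
  -- The context depends on `q.1` only, so the realizer is the same for all arguments `q.2` in `Ω`,
  -- as `Ent.inter` requires.
  have h : Ent pitts (fun q : I × Set ℕ => Γ q.1)
      (fun q => ex fun x => conj (T x) (R q.1 q.2 x)) := by
    have hR' := hR.subst fun q : I × Set ℕ => q.1
    have tot : Ent pitts (fun q : I × Set ℕ => Γ q.1) (fun q => ex (R q.1 q.2)) :=
      isFun_tot hR' (omega_refl fun q : I × Set ℕ => q.2)
    refine tot.exE fun Δ hΔ k => ?_
    have hR'' : Ent pitts Δ (fun q => isFun (omega pitts) X (R q.1.1)) :=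
      hΔ.trans (hR.subst fun q : (I × Set ℕ) × X.carrier => q.1.1)
    have hx : Ent pitts Δ (fun q => X.eq q.2 q.2) :=
      (isFun_strict (A := omega pitts) (R := fun q : (I × Set ℕ) × X.carrier => R q.1.1)
        (a := fun q => q.1.2) (y := fun q => q.2) hR'' k).snd
    exact Ent.exI (fun q => q.2)
      (Ent.and (hx.trans (hT.subst fun q : (I × Set ℕ) × X.carrier => q.2)) k)
  -- A number in the intersection is a pair whose first component names both values and whose second
  -- component realizes `R` at both arguments; the second component is therefore duplicated.
  have h2 : Ent pitts Γ (fun i => ex fun q : X.carrier × X.carrier =>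
      conj (T q.1 ∩ T q.2) (conj (R i (p i) q.1) (R i (p' i) q.2))) := by
    refine (Ent.inter (φ := fun i s => ex fun x => conj (T x) (R i s x)) h p p').trans ?_
    obtain ⟨r, hr, hr'⟩ := exists_ret pitts
    refine ent_of (fun a => r (Nat.pair a.unpair.1 (Nat.pair a.unpair.2 a.unpair.2))) ?_ ?_
    · have h1 := Computable.snd.comp Computable.unpair
      exact hr.comp (Primrec₂.natPair.to_comp.comp (Computable.fst.comp Computable.unpair)
        (Primrec₂.natPair.to_comp.comp h1 h1))
    · rintro i a ⟨ha, ha'⟩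
      obtain ⟨x, hx⟩ := Set.mem_iUnion.1 ha
      obtain ⟨x', hx'⟩ := Set.mem_iUnion.1 ha'
      rw [mem_conj] at hx hx'
      exact hr' _ _ (Set.mem_iUnion.2 ⟨(x, x'), ⟨_, ⟨hx.1, hx'.1⟩, _,
        ⟨_, hx.2, _, hx'.2, rfl⟩, rfl⟩⟩)
  refine h2.exE fun Δ hΔ k => ?_
  have e : Ent pitts Δ (fun q => X.eq q.2.1 q.2.2) :=
    k.fst.trans (hT'.subst fun q : I × X.carrier × X.carrier => q.2)
  exact Ent.exI (fun q => q.2.2)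
    (Ent.and (isFun_congr (hR.pull (f := Prod.fst) hΔ) k.snd.fst
      (omega_refl fun q : I × X.carrier × X.carrier => p q.1) e) k.snd.snd)

/-- A value at one argument `p₀` is, by `exists_common_value` and single-valuedness, the value at
all arguments. -/
theorem constRel_of_value
    (hT : Ent pitts (fun x : X.carrier => X.eq x x) T)
    (hT' : Ent pitts (fun p : X.carrier × X.carrier => T p.1 ∩ T p.2) (fun p => X.eq p.1 p.2))
    {Γ : I → Set ℕ} {R : I → Set ℕ → X.carrier → Set ℕ} {p₀ : I → Set ℕ} {x : I → X.carrier}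
    (hR : Ent pitts Γ (fun i => isFun (omega pitts) X (R i)))
    (hx : Ent pitts Γ (fun i => R i (p₀ i) (x i))) :
    Ent pitts Γ (fun i => (curryRel (sndRel (omega pitts) X)).rel (x i) (R i)) := by
  have h := isFun_strict hR hx
  have key : Ent pitts (fun j : I × Set ℕ × X.carrier => Γ j.1)
      (fun j => R j.1 j.2.1 (x j.1)) := by
    have hR' := hR.subst fun j : I × Set ℕ × X.carrier => j.1
    refine (exists_common_value hT hT' hR' (fun j => p₀ j.1) (fun j => j.2.1)).exE
      fun Δ hΔ k => ?_
    have hR'' := hR'.pull (f := fun q : (I × Set ℕ × X.carrier) × X.carrier => q.1) hΔ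
    exact isFun_congr hR'' k.snd
      (omega_refl fun q : (I × Set ℕ × X.carrier) × X.carrier => q.1.2.1)
      (isFun_sv hR'' k.fst ((hx.subst fun j : I × Set ℕ × X.carrier => j.1).pull hΔ))
  refine Ent.and h.snd (Ent.and hR (Ent.allI (Ent.biimpI (fun Δ hΔ l => ?_) fun Δ hΔ l => ?_)))
  · have e := isFun_sv (hR.pull hΔ) (key.pull (f := fun j => j) hΔ) l
    exact Ent.and (Ent.and (omega_refl fun j : I × Set ℕ × X.carrier => j.2.1) (X.eq_left e)) e
  · exact isFun_congr (hR.pull hΔ) (key.pull (f := fun j => j) hΔ)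
      (omega_refl fun j : I × Set ℕ × X.carrier => j.2.1) l.snd

/-- If the elements of `X` have names, each of which determines its element effectively, then
the map `X ⟶ X ^ Ω` is an isomorphism. -/
theorem isIso_constMap_of_names
    (hT : Ent pitts (fun x : X.carrier => X.eq x x) T)
    (hT' : Ent pitts (fun p : X.carrier × X.carrier => T p.1 ∩ T p.2) (fun p => X.eq p.1 p.2)) :
    IsIso (constMap (omega pitts) X) := by
  rw [constMap_eq]
  refine isIso_homMk _ constRel_injective ?_
  have h : Ent pitts (fun R : Set ℕ → X.carrier → Set ℕ => (expo (omega pitts) X).eq R R)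
      (fun R => isFun (omega pitts) X R) := (Ent.refl _).fst
  -- The preimage of `R` is its value at `∅`; any fixed element of `Ω` would do.
  refine Ent.exE (isFun_tot h (omega_refl fun _ => ∅)) fun Δ hΔ k => ?_
  exact Ent.exI (fun i => i.2) (constRel_of_value hT hT' (h.pull hΔ) k)

end Uniformity

/-- A name of `x` is a numeral `n` together with realizers that some `s` in `S` is sent to `x` by
the quotient map and to `n` by the inclusion. Names exist since the quotient map is internally
surjective. If `x` and `x'` share a name, the corresponding `s` and `s'` lie over the same `n`, so
they are equal by injectivity of the inclusion, and hence so are `x` and `x'`. -/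
theorem isIso_constMap_of_isSubquotient {X : Eff pitts} (h : IsSubquotient X (nat pitts)) :
    IsIso (constMap (omega pitts) X) := by
  obtain ⟨S, m, q, _, _⟩ := h
  obtain ⟨M, rfl⟩ := homMk_surj m
  obtain ⟨Q, rfl⟩ := homMk_surj q
  refine isIso_constMap_of_names (T := fun x => ex fun p : S.carrier × ℕ =>
    conj {p.2} (conj (Q.rel p.1 x) (M.rel p.1 p.2))) ?_ ?_
  · refine (surjective_of_epi Q).exE fun Δ hΔ k => ?_
    refine Ent.exE (M.tot (Q.left k)) fun Δ' hΔ' l => ?_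
    refine Ent.exI (fun i => (i.1.2, i.2)) (Ent.and ?_ ((k.pull hΔ').and l))
    exact (M.right l).trans (Ent.of_subset fun i n hn => hn.2)
  · have h : Ent pitts (fun p : X.carrier × X.carrier =>
        (ex fun p' : S.carrier × ℕ => conj {p'.2} (conj (Q.rel p'.1 p.1) (M.rel p'.1 p'.2))) ∩
        (ex fun p' : S.carrier × ℕ => conj {p'.2} (conj (Q.rel p'.1 p.2) (M.rel p'.1 p'.2))))
        (fun p => ex fun s : ℕ × S.carrier × S.carrier =>
          conj (conj (Q.rel s.2.1 p.1) (M.rel s.2.1 s.1))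
            (conj (Q.rel s.2.2 p.2) (M.rel s.2.2 s.1))) := by
      obtain ⟨r, hr, hr'⟩ := exists_ret pitts
      refine ent_of (fun a => r (Nat.pair a.unpair.2 a.unpair.2)) ?_ ?_
      · have h1 := Computable.snd.comp Computable.unpair
        exact hr.comp (Primrec₂.natPair.to_comp.comp h1 h1)
      · rintro i a ⟨ha, ha'⟩
        obtain ⟨⟨s, n⟩, hx⟩ := Set.mem_iUnion.1 ha
        obtain ⟨⟨s', n'⟩, hx'⟩ := Set.mem_iUnion.1 ha'
        rw [mem_conj] at hx hx'
        -- The numeral is literally the first component of the common name, and this is what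
        -- identifies `n` with `n'`.
        obtain rfl : n = n' := hx.1.symm.trans hx'.1
        exact hr' _ _ (Set.mem_iUnion.2 ⟨(n, s, s'), ⟨_, hx.2, _, hx'.2, rfl⟩⟩)
    refine h.exE fun Δ _ k => ?_
    have e : Ent pitts Δ (fun i => S.eq i.2.2.1 i.2.2.2) :=
      (k.fst.snd.and k.snd.snd).trans ((injective_of_mono M).subst
      fun i : (X.carrier × X.carrier) × ℕ × S.carrier × S.carrier => i.2)
    exact Q.sv (Q.congr_left k.fst.fst e) k.snd.fst

/-- Disjointness of the sets of realizers makes the realizers themselves into names. -/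
theorem isIso_constMap_assembly {X : Type} {E : X → Set ℕ}
    (h : ∀ x y, (E x ∩ E y).Nonempty → x = y) :
    IsIso (constMap (omega pitts) (assembly pitts X E)) :=
  isIso_constMap_of_names (T := E) (Ent.of_subset fun _ _ hn => hn.2)
    (Ent.of_subset fun _ n hn => ⟨h _ _ ⟨n, hn⟩, hn.1⟩)

/-- If `f n ≠ g n`, the value of the index at `n` lies in `J {f n} ∩ J {g n} ⊆ J ∅`, and `J ∅` is
empty. -/
theorem representers_injective {f g : ℕ → ℕ} {e : ℕ} (hf : e ∈ representers pitts f)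
    (hg : e ∈ representers pitts g) : f = g := by
  funext n
  obtain ⟨m, hm, hm'⟩ := hf n
  obtain ⟨k, hk, hk'⟩ := hg n
  obtain rfl := Part.mem_unique hm hk
  by_contra hne
  have h : m ∈ leastLocal pittsF ({f n} ∩ {g n}) := leastLocal_pittsF_inter _ _ ⟨hm', hk'⟩
  have h0 : ({f n} ∩ {g n} : Set ℕ) = ∅ := by simpa using Ne.symm hne
  rw [h0] at h
  -- The empty set is closed under both clauses: an element of `pittsF ∅` would take a value in `∅`
  -- at its threshold.
  refine @pitts_ind ∅ ∅ (by simp) (fun f hf => ?_) m h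
  obtain ⟨n, hn⟩ := Set.mem_iUnion.1 hf
  obtain ⟨_, _, hb⟩ := hn n (Set.mem_Ici.2 le_rfl)
  exact hb

/-- A common realizer of two classes represents `β ∘ ψ` and `γ ∘ ψ` with `β`, `γ` in the respective
classes. These composites then agree everywhere, so the classes coincide, whatever `ψ` is. -/
theorem isIso_constMap_skolem (ψ : ℕ → ℕ) :
    IsIso (constMap (omega pitts) (skolem pitts ψ)) := by
  refine isIso_constMap_assembly ?_
  rintro x y ⟨e, ⟨β, rfl, hβ⟩, ⟨γ, rfl, hγ⟩⟩
  exact Quotient.sound (Filter.Eventually.of_forall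
    fun n => congrFun (representers_injective hβ hγ) n)

/-! ### Exponentials -/

section Closed

variable {C : Type*} [Category C] [CartesianMonoidalCategory C] [MonoidalClosed C]

theorem comp_constMap {A X Z : C} (f : Z ⟶ X) :
    f ≫ constMap A X = MonoidalClosed.curry (snd A Z ≫ f) := by
  rw [constMap, ← MonoidalClosed.curry_natural_left, whiskerLeft_snd]

/-- By the Yoneda lemma and transposition, invertibility says that every map `A ⊗ Z ⟶ X` factors
uniquely through the projection to `Z`. In this form exponents are easily exchanged. -/
theorem isIso_constMap_iff (A X : C) : IsIso (constMap A X) ↔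
    ∀ Z : C, Function.Bijective fun f : Z ⟶ X => snd A Z ≫ f := by
  rw [isIso_iff_yoneda_map_bijective]
  refine forall_congr' fun Z => ?_
  have : (fun f : Z ⟶ X => f ≫ constMap A X) =
      MonoidalClosed.curry ∘ fun f : Z ⟶ X => snd A Z ≫ f := funext comp_constMap
  rw [this]
  exact ((ihom.adjunction A).homEquiv Z X).comp_bijective _

/-- Maps `A ⊗ Z ⟶ X ^ B` correspond to maps `A ⊗ (B ⊗ Z) ⟶ X`, so the criterion for `X ^ B` at `Z`
is the criterion for `X` at `B ⊗ Z`. -/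
theorem isIso_constMap_ihom {A X : C} (B : C) (h : IsIso (constMap A X)) :
    IsIso (constMap A ((ihom B).obj X)) := by
  rw [isIso_constMap_iff] at h ⊢
  intro Z
  let e : B ⊗ (A ⊗ Z) ≅ A ⊗ (B ⊗ Z) :=
    { hom := lift (snd _ _ ≫ fst _ _) (B ◁ snd A Z)
      inv := lift (snd _ _ ≫ fst _ _) (A ◁ snd B Z) }
  have he : e.hom ≫ snd A (B ⊗ Z) = B ◁ snd A Z := lift_snd _ _
  -- Composition with the projection is decomposed into uncurrying over `B`, composition with the
  -- projection from `A ⊗ (B ⊗ Z)`, exchange of `A` and `B`, and currying; only the second of these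
  -- needs the hypothesis.
  have : (fun f : Z ⟶ (ihom B).obj X => snd A Z ≫ f) =
      ((ihom.adjunction B).homEquiv (A ⊗ Z) X) ∘ (e.homFromEquiv.symm) ∘
      (fun f : B ⊗ Z ⟶ X => snd A (B ⊗ Z) ≫ f) ∘
      ((ihom.adjunction B).homEquiv Z X).symm := by
    funext f
    obtain ⟨g, rfl⟩ := ((ihom.adjunction B).homEquiv Z X).surjective f
    simp only [Function.comp_apply, Equiv.symm_apply_apply]
    change snd A Z ≫ MonoidalClosed.curry g =
      MonoidalClosed.curry (e.hom ≫ snd A (B ⊗ Z) ≫ g)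
    rw [← Category.assoc, he, MonoidalClosed.curry_natural_left]
  rw [this]
  exact (Equiv.bijective _).comp ((Equiv.bijective _).comp ((h (B ⊗ Z)).comp (Equiv.bijective _)))

end Closed

end JRealizability

open JRealizability
theorem mainTheorem5 :
    (∀ X : Eff pitts, IsSubquotient X (nat pitts) → IsIso (constMap (omega pitts) X)) ∧
    IsIso (constMap (omega pitts) (nat pitts)) ∧
    IsIso (constMap (omega pitts) ((ihom (nat pitts)).obj (nat pitts))) ∧
    ∀ ψ : ℕ → ℕ,
      IsIso (constMap (omega pitts) (skolem pitts ψ)) ∧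
      IsIso (constMap (omega pitts) ((ihom (skolem pitts ψ)).obj (skolem pitts ψ))) := by
  have hN : IsIso (constMap (omega pitts) (nat pitts)) :=
    isIso_constMap_assembly fun x y ⟨n, hx, hy⟩ => hx.symm.trans hy
  exact ⟨fun _ h => isIso_constMap_of_isSubquotient h, hN, isIso_constMap_ihom _ hN,
    fun ψ => ⟨isIso_constMap_skolem ψ, isIso_constMap_ihom _ (isIso_constMap_skolem ψ)⟩⟩
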